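/- **Theorem.** Summation over repeated indices is understood. Let $(M,g)$ be a smooth $n$-dimensional pseudo-Riemannian manifold on which an $n$-dimensional Lie group $G$ acts smoothly on the left, simply transitively and by isometries. Let $e_1,\dots,e_n$ be a basis of the Lie algebra $\mathfrak g$ of $G$, $[e_i,e_j]=C_{ij}^k e_k$. Fix $x_0\in M$ and let $\psi:G\to M$, $\psi(z)=z\cdot x_0$. Let $\xi_i$ be the image under $\psi$ of the left-invariant vector field on $G$ equal to $e_i$ at the identity, let $\omega^1,\dots,\omega^n$ be the 1-forms on $M$ dual to $\xi_1,\dots,\xi_n$, and let $(\mathbf G^{ij})$ be the inverse of the matrix $\mathbf G_{ij}=g(\psi_*e_i,\psi_*e_j)$. *Orbits.* Let $k=\operatorname{ind}\mathfrak g=\inf_{\mu\in\mathfrak g^*}\operatorname{corank}\|C_{ij}^l\mu_l\|$ and $r=(n-k)/2$, so that coadjoint orbits of regular elements (those with orbit of maximal dimension) have dimension $2r$. Let $j\mapsto\lambda(j)$, $j\in J\subset\mathbb R^k$ open, be a smooth local parametrization of regular coadjoint orbits: there is a $G$-invariant open set $U\subset\mathfrak g^*$ and a smooth map $K:U\to J$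 whose fibres are the coadjoint orbits in $U$, and $\lambda:J\to U$ is smooth with regular values and $K(\lambda(j))=j$. *Polarization.* Let $\mathfrak h\subset\mathfrak g$ be a subalgebra that is a polarization of every $\lambda(j)$, i.e. $\dim\mathfrak h=\dim\mathfrak g-\tfrac12\dim\mathcal O_{\lambda(j)}$ and $\langle\lambda(j),[\mathfrak h,\mathfrak h]\rangle=0$, and let $H\subset G$ be a closed subgroup with Lie algebra $\mathfrak h$. Let $\rho_z(Hw)=Hwz$ be the right action of $G$ on $Q=H\backslash G$, and put $\varphi(x,q)=\rho_{\psi^{-1}(x)}q$ for $x\in M$, $q\in Q$. Fix local coordinates $x^1,\dots,x^n$ on $M$ and $q^1,\dots,q^r$ on $Q$; let $V\subset\mathbb R^r$ be the range of the latter, and let $\zeta_i=\zeta_i^a(q)\,\partial_{q^a}$ be the infinitesimal generators of the action on $Q$ corresponding to $e_i$. *Canonical coordinates.* Let $\chi_i(q;\lambda(j))$ be smooth functions of $(q,j)\in V\times J$ such that the functions $f_i(q,p;\lambda(j))=\zeta_i^a(q)p_a+\chi_i(q;\lambda(j))$, $q\in V$, $p\in\mathbb R^r$, satisfy $$\frac{\partial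 f_i}{\partial p_a}\frac{\partial f_l}{\partial q^a}-\frac{\partial f_i}{\partial q^a}\frac{\partial f_l}{\partial p_a}=C_{il}^s f_s$$ and give canonical coordinates $(p,q)$ on $\mathcal O_{\lambda(j)}$ for $(j,q,p)$ in an open set $T\subset J\times V\times\mathbb R^r$: for $(j,q,p)\in T$ the numbers $f_i(q,p;\lambda(j))$ are the components of a point of $\mathcal O_{\lambda(j)}$, and $\operatorname{rank}\|\partial f_i/\partial q^a,\ \partial f_i/\partial p_a\|=\dim\mathcal O_{\lambda(j)}$. *Complete integrals.* A complete integral of an equation $F(y,\partial S/\partial y)=m^2$ in $d$ variables, with a parameter $m\ge0$, is a family of solutions $S(y;\alpha)$ depending on $d$ real parameters $\alpha$, for values $m=m(\alpha)$ that may depend on $\alpha$, such that $\det\|\partial^2S/\partial y^i\partial\alpha_l\|\ne0$. It is of class $C^N$ if $S$ is $C^N$ in $(y,\alpha)$ on an open domain. Let $2\le N\le\infty$, and let $\tilde S_j(q;\beta)$, $\beta=(\beta_1,\dots,\beta_r)$, be of class $C^N$ in $(j,q,\beta)$ on an open set $\Omega$ and, for each $j\in J$, a complete integral of the reduced equation $$\mathbf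 G^{il}f_i\Big(q,\frac{\partial\tilde S}{\partial q};\lambda(j)\Big)f_l\Big(q,\frac{\partial\tilde S}{\partial q};\lambda(j)\Big)=m^2,\qquad m=m(j,\beta),$$ on $Q$, with $(j,q,\partial\tilde S_j/\partial q)\in T$ on $\Omega$. Then: 1. the integral $\int\chi_l(\varphi(x,q);\lambda(j))\,\omega^l(x)$ exists: if $B$ is a convex open set of coordinates $x$ and $P$ an open set of pairs $(q,j)\in V\times J$, and $\varphi(x,q)$ lies in the coordinate domain of $Q$ for all $x\in B$, $(q,j)\in P$, then there is a smooth function on $B\times P$ whose differential with respect to $x$ is the 1-form $\chi_l(\varphi(x,q);\lambda(j))\,\omega^l(x)$; 2. for every choice of the integral as a $C^N$ function of $(x,q,j)$ on an open set $D$ of triples with $q\in V$, $j\in J$ and $\varphi(x,q)$ in the coordinate domain of $Q$, the function $$S(x;\alpha)=\tilde S_j(\varphi(x,q);\beta)+\int\chi_l(\varphi(x,q);\lambda(j))\,\omega^l(x),\qquad \alpha=(q,j,\beta),$$ is, with $m=m(j,\beta)$, a complete integral of class $C^N$ of the geodesic Hamilton–Jacobi equation $g^{il}\,\dfrac{\partial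 S}{\partial x^i}\dfrac{\partial S}{\partial x^l}=m^2$ on the open set of all $(x;q,j,\beta)$ with $(x,q,j)\in D$ and $(j,\varphi(x,q),\beta)\in\Omega$. -/

import Mathlib

open scoped Manifold ContDiff

noncomputable section

namespace GeodesicHJ

/-- The coordinate space `ℝ^d`. -/
abbrev Coord (d : ℕ) := EuclideanSpace ℝ (Fin d)

/-! ### Complete integrals of Hamilton-Jacobi equations -/

/-- The partial derivative `∂u/∂x^i` at `x`. -/
def partialDeriv {d : ℕ} (u : Coord d → ℝ) (i : Fin d) (x : Coord d) : ℝ :=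
  fderiv ℝ u x (EuclideanSpace.single i 1)

/-- The covector `(∂u/∂x^1, …, ∂u/∂x^d)` at `x`. -/
def grad {d : ℕ} (u : Coord d → ℝ) (x : Coord d) : Coord d :=
  WithLp.toLp 2 fun i => partialDeriv u i x

/-- `S (x; α)` is a complete integral, of class `C^N` on the domain `D`, of the first-order equation
`F (x, ∂S/∂x) = m²` with a non-negative parameter `m`, which may be a function of the parameters
`α`.  The parameter `α` ranges over a `d`-dimensional space `A`; in linear coordinates
`α_1, …, α_d` on `A`, given by a basis `v`, one has `det ‖∂²S / ∂x^i ∂α_l‖ ≠ 0` on `D` (a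
condition that does not depend on `v`). -/
structure IsCompleteIntegral {d : ℕ} {A : Type*} [NormedAddCommGroup A] [NormedSpace ℝ A]
    (N : WithTop ℕ∞) (F : Coord d → Coord d → ℝ) (m : A → ℝ) (D : Set (Coord d × A))
    (S : Coord d → A → ℝ) : Prop where
  isOpen : IsOpen D
  contDiffOn : ContDiffOn ℝ N (fun t : Coord d × A => S t.1 t.2) D
  mass_nonneg : ∀ x α, (x, α) ∈ D → 0 ≤ m α
  equation : ∀ x α, (x, α) ∈ D → F x (grad (fun x' => S x' α) x) = m α ^ 2
  nondegenerate : ∃ v : Module.Basis (Fin d) ℝ A, ∀ x α, (x, α) ∈ D →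
    (Matrix.of fun i l : Fin d =>
      fderiv ℝ (fun α' => partialDeriv (fun x' => S x' α') i x) α (v l)).det ≠ 0

/-! ### Pseudo-Riemannian metrics and the geodesic Hamilton-Jacobi equation -/

section Metric

variable {n : ℕ} {M : Type*} [TopologicalSpace M] [ChartedSpace (Coord n) M]

variable (n M) in
/-- A smooth pseudo-Riemannian metric. -/
structure PseudoRiemannianMetric [IsManifold (𝓡 n) ∞ M] where
  /-- The scalar product on each tangent space. -/
  val (x : M) : TangentSpace (𝓡 n) x →L[ℝ] TangentSpace (𝓡 n) x →L[ℝ] ℝ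
  symm (x : M) (v w : TangentSpace (𝓡 n) x) : val x v w = val x w v
  nondegenerate (x : M) (v : TangentSpace (𝓡 n) x) : (∀ w, val x v w = 0) → v = 0
  contMDiff : ContMDiff (𝓡 n) ((𝓡 n).prod 𝓘(ℝ, Coord n →L[ℝ] Coord n →L[ℝ] ℝ)) ∞
    (fun x ↦ Bundle.TotalSpace.mk' (Coord n →L[ℝ] Coord n →L[ℝ] ℝ)
      (E := fun y : M => TangentSpace (𝓡 n) y →L[ℝ] TangentSpace (𝓡 n) y →L[ℝ] ℝ) x (val x))

/-- The coordinate vector `∂/∂x^i` of the chart `e`, at the point with coordinates `x`. -/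
def coordVector (e : OpenPartialHomeomorph M (Coord n)) (x : Coord n) (i : Fin n) :
    TangentSpace (𝓡 n) (e.symm x) :=
  mfderiv (𝓡 n) (𝓡 n) e.symm x (EuclideanSpace.single i (1 : ℝ) : Coord n)

variable [IsManifold (𝓡 n) ∞ M]

/-- The covariant components `g_{ij}(x)` of the metric in the chart `e`. -/
def metricMatrix (g : PseudoRiemannianMetric n M) (e : OpenPartialHomeomorph M (Coord n))
    (x : Coord n) : Matrix (Fin n) (Fin n) ℝ :=
  Matrix.of fun i j => g.val (e.symm x) (coordVector e x i) (coordVector e x j)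

/-- The left-hand side `g^{ij}(x) p_i p_j` of the geodesic Hamilton-Jacobi equation. -/
def geodesicSymbol (g : PseudoRiemannianMetric n M) (e : OpenPartialHomeomorph M (Coord n))
    (x p : Coord n) : ℝ :=
  ∑ i, ∑ j, (metricMatrix g e x)⁻¹ i j * p i * p j

end Metric

/-! ### Simply transitive isometry groups -/

section Action

variable {n : ℕ} {G : Type*} [TopologicalSpace G] [ChartedSpace (Coord n) G] [Group G]
  {M : Type*} [TopologicalSpace M] [ChartedSpace (Coord n) M] [MulAction G M]

variable (G) in
/-- `G` acts by isometries of `g`. -/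
def ActsByIsometries [IsManifold (𝓡 n) ∞ M] (g : PseudoRiemannianMetric n M) : Prop :=
  ∀ (z : G) (x : M) (v w : TangentSpace (𝓡 n) x),
    g.val (z • x) (mfderiv (𝓡 n) (𝓡 n) (fun y : M => z • y) x v)
      (mfderiv (𝓡 n) (𝓡 n) (fun y : M => z • y) x w) = g.val x v w

variable (G M) in
/-- The action is simply transitive. -/
def SimplyTransitive : Prop := ∀ x₁ x₂ : M, ∃! z : G, z • x₁ = x₂

variable (G) in
/-- The inverse of the map `ψ : G → M`, `ψ z = z • x₀`. -/
def psiInv (x₀ : M) : M → G := Function.invFun fun z : G => z • x₀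

/-- The `G`-invariant vector field `ξ_k` on `M`: the image under `ψ` of the left-invariant vector
field on `G` that is equal to `e_k` at the identity. -/
def xi (b : Module.Basis (Fin n) ℝ (GroupLieAlgebra (𝓡 n) G)) (x₀ : M) (k : Fin n) (y : M) :
    TangentSpace (𝓡 n) y :=
  mfderiv (𝓡 n) (𝓡 n) (fun z : G => z • x₀) (psiInv G x₀ y)
    (mulInvariantVectorField (I := 𝓡 n) (b k) (psiInv G x₀ y))

/-- The components `ξ_k^i(x)` (row `i`, column `k`) of the fields `ξ_k` in the chart `e`. -/
def frameMatrix (e : OpenPartialHomeomorph M (Coord n))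
    (b : Module.Basis (Fin n) ℝ (GroupLieAlgebra (𝓡 n) G)) (x₀ : M) (x : Coord n) :
    Matrix (Fin n) (Fin n) ℝ :=
  Matrix.of fun i k =>
    let v : Coord n := mfderiv (𝓡 n) (𝓡 n) e (e.symm x) (xi b x₀ k (e.symm x))
    v i

/-- The components `ω^k_i(x)` (row `k`, column `i`), in the chart `e`, of the 1-forms `ω^k` that
are dual to the fields `ξ_k`. -/
def coframeMatrix (e : OpenPartialHomeomorph M (Coord n))
    (b : Module.Basis (Fin n) ℝ (GroupLieAlgebra (𝓡 n) G)) (x₀ : M) (x : Coord n) :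
    Matrix (Fin n) (Fin n) ℝ :=
  (frameMatrix e b x₀ x)⁻¹

/-- The constant matrix `𝐆_{ij} = g(ψ_* e_i, ψ_* e_j)`. -/
def gramMatrix [IsManifold (𝓡 n) ∞ M] (g : PseudoRiemannianMetric n M)
    (b : Module.Basis (Fin n) ℝ (GroupLieAlgebra (𝓡 n) G)) (x₀ : M) :
    Matrix (Fin n) (Fin n) ℝ :=
  Matrix.of fun i j => g.val ((1 : G) • x₀)
    (mfderiv (𝓡 n) (𝓡 n) (fun z : G => z • x₀) 1 (b i))
    (mfderiv (𝓡 n) (𝓡 n) (fun z : G => z • x₀) 1 (b j))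

end Action

/-! ### Coadjoint orbits -/

section Coadjoint

variable {n : ℕ} {G : Type*} [TopologicalSpace G] [ChartedSpace (Coord n) G] [Group G]

variable (n) in
/-- The dual space `𝔤*` of the Lie algebra `𝔤` of `G`.  (As a vector space, the tangent space `𝔤` at
the identity is by definition the model space `ℝ^n`; writing it so gives `𝔤*` its norm.) -/
abbrev DualLie (_G : Type*) := Coord n →L[ℝ] ℝ

/-- The adjoint representation: the differential at the identity of `w ↦ z w z⁻¹`. -/
def Ad (z : G) : GroupLieAlgebra (𝓡 n) G →L[ℝ] GroupLieAlgebra (𝓡 n) G :=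
  mfderiv (𝓡 n) (𝓡 n) (fun w : G => z * w * z⁻¹) 1

/-- The coadjoint representation: `⟨Ad*_z μ, Z⟩ = ⟨μ, Ad_{z⁻¹} Z⟩`. -/
def coadjoint (z : G) (μ : DualLie n G) : DualLie n G :=
  ContinuousLinearMap.comp (M₂ := GroupLieAlgebra (𝓡 n) G) μ (Ad z⁻¹)

/-- The coadjoint orbit `𝒪_μ`. -/
def coadjointOrbit (μ : DualLie n G) : Set (DualLie n G) :=
  Set.range fun z : G => coadjoint z μ

/-- The matrix `C_{ij}^k μ_k = ⟨μ, [e_i, e_j]⟩`. -/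
def kirillovMatrix (b : Module.Basis (Fin n) ℝ (GroupLieAlgebra (𝓡 n) G)) (μ : DualLie n G) :
    Matrix (Fin n) (Fin n) ℝ :=
  Matrix.of fun i j => μ (⁅b i, b j⁆ : GroupLieAlgebra (𝓡 n) G)

/-- The dimension of the coadjoint orbit of `μ`, that is, the rank of `C_{ij}^k μ_k`. -/
def orbitDim (b : Module.Basis (Fin n) ℝ (GroupLieAlgebra (𝓡 n) G)) (μ : DualLie n G) : ℕ :=
  (kirillovMatrix b μ).rank

/-- The index of `𝔤`: the infimum over `μ` of the corank of `C_{ij}^k μ_k`. -/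
def lieIndex (b : Module.Basis (Fin n) ℝ (GroupLieAlgebra (𝓡 n) G)) : ℕ :=
  ⨅ μ : DualLie n G, (n - orbitDim b μ)

/-- `μ` is regular: its coadjoint orbit has the maximal dimension. -/
def IsRegular (b : Module.Basis (Fin n) ℝ (GroupLieAlgebra (𝓡 n) G)) (μ : DualLie n G) : Prop :=
  ∀ ν : DualLie n G, orbitDim b ν ≤ orbitDim b μ

/-- `j ↦ lam j`, `j ∈ J ⊆ ℝ^k`, is a smooth local parametrization of regular coadjoint orbits.
There is an open `G`-invariant set `U ⊆ 𝔤*` whose orbit space `U / G` is a manifold with the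
coordinates `j ∈ J` (`K : U → J` is the projection onto the orbit space, written in these
coordinates: it is smooth, and its fibres are the coadjoint orbits in `U`), and `lam` is a smooth
section of `K` with regular values. -/
structure IsOrbitParametrization {k : ℕ}
    (b : Module.Basis (Fin n) ℝ (GroupLieAlgebra (𝓡 n) G)) (J : Set (Coord k))
    (lam : Coord k → DualLie n G) : Prop where
  isOpen : IsOpen J
  contDiffOn : ContDiffOn ℝ ∞ lam J
  regular : ∀ j ∈ J, IsRegular b (lam j)
  fibration : ∃ (U : Set (DualLie n G)) (K : DualLie n G → Coord k),
    IsOpen U ∧ (∀ (z : G), ∀ μ ∈ U, coadjoint z μ ∈ U) ∧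
    ContDiffOn ℝ ∞ K U ∧ Set.MapsTo K U J ∧
    (∀ μ ∈ U, ∀ ν ∈ U, K μ = K ν ↔ ν ∈ coadjointOrbit μ) ∧
    ∀ j ∈ J, lam j ∈ U ∧ K (lam j) = j

/-- The functions `f_i(q, p)`, `q ∈ V ⊆ ℝ^r`, `p ∈ ℝ^r`, define the transition to canonical
coordinates `(p, q)` on the coadjoint orbit of `μ`, with `(q, p)` in the coordinate domain `T`:
their canonical Poisson brackets are `{f_i, f_j} = C_{ij}^k f_k`, and on `T` they are the components
of points of the orbit, with a Jacobi matrix of rank equal to the dimension of the orbit. -/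
structure IsCanonicalTransition {r : ℕ}
    (b : Module.Basis (Fin n) ℝ (GroupLieAlgebra (𝓡 n) G)) (μ : DualLie n G)
    (V : Set (Coord r)) (T : Set (Coord r × Coord r)) (f : Fin n → Coord r → Coord r → ℝ) :
    Prop where
  contDiffOn : ∀ i, ContDiffOn ℝ ∞ (fun t : Coord r × Coord r => f i t.1 t.2) (V ×ˢ Set.univ)
  bracket : ∀ q ∈ V, ∀ p, ∀ i j,
    ∑ a, (partialDeriv (fun p' => f i q p') a p * partialDeriv (fun q' => f j q' p) a q
        - partialDeriv (fun q' => f i q' p) a q * partialDeriv (fun p' => f j q p') a p)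
      = ∑ l, b.repr ⁅b i, b j⁆ l * f l q p
  mem_orbit : ∀ q p, (q, p) ∈ T → ∃ ν ∈ coadjointOrbit μ, ∀ i, f i q p = ν (b i)
  rank : ∀ q p, (q, p) ∈ T →
    (Matrix.of fun (i : Fin n) (s : Fin r ⊕ Fin r) =>
      Sum.elim (fun a => partialDeriv (fun q' => f i q' p) a q)
        (fun a => partialDeriv (fun p' => f i q p') a p) s).rank = orbitDim b μ

end Coadjoint

/-- Over `ℝ` a smooth Lie group has the regularity that Mathlib asks for in the construction of the
Lie algebra structure on the tangent space at the identity. -/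
instance instLEInfty : ENat.LEInfty (minSmoothness ℝ 3) :=
  ⟨by rw [minSmoothness_of_isRCLikeNormedField]; exact ENat.LEInfty.out⟩

section Subgroups

variable {n : ℕ} {G : Type*} [TopologicalSpace G] [ChartedSpace (Coord n) G] [Group G]
  [LieGroup (𝓡 n) ∞ G]

/-- `𝔥` is a polarization of `μ`: a subalgebra that is subordinate to `μ`, with
`dim 𝔥 = dim 𝔤 - (1/2) dim 𝒪_μ`. -/
structure IsPolarization (b : Module.Basis (Fin n) ℝ (GroupLieAlgebra (𝓡 n) G))
    (𝔥 : LieSubalgebra ℝ (GroupLieAlgebra (𝓡 n) G)) (μ : DualLie n G) : Prop where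
  finrank_eq : 2 * Module.finrank ℝ 𝔥 + orbitDim b μ = 2 * n
  subordinate : ∀ X ∈ 𝔥, ∀ Y ∈ 𝔥, μ (⁅X, Y⁆ : GroupLieAlgebra (𝓡 n) G) = 0

/-- `𝔥` is the Lie algebra of the subgroup `H`: it consists of the velocities `X` at `t = 0` of the
one-parameter subgroups `t ↦ γ t = exp (t X)` of `G` that are contained in `H`. -/
def IsLieAlgebraOf (𝔥 : LieSubalgebra ℝ (GroupLieAlgebra (𝓡 n) G)) (H : Subgroup G) : Prop :=
  ∀ X : GroupLieAlgebra (𝓡 n) G, X ∈ 𝔥 ↔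
    ∃ γ : ℝ → G, ContMDiff 𝓘(ℝ, ℝ) (𝓡 n) ∞ γ ∧ (∀ s t, γ (s + t) = γ s * γ t) ∧
      (mfderiv 𝓘(ℝ, ℝ) (𝓡 n) γ 0 (1 : ℝ) : Coord n) = X ∧ ∀ t, γ t ∈ H

end Subgroups

/-! ### The homogeneous space `H \ G` -/

section Homogeneous

variable {n r : ℕ} {G : Type*} [Group G]

/-- The space `Q = H \ G` of right cosets `H z` (with the quotient topology). -/
abbrev RightQuotient (H : Subgroup G) := Quotient (QuotientGroup.rightRel H)

/-- The projection `G → H \ G`, `z ↦ H z`. -/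
def proj (H : Subgroup G) (z : G) : RightQuotient H := Quotient.mk _ z

/-- The right action `ρ_z (H w) = H w z` of `G` on `Q = H \ G`. -/
def rho {H : Subgroup G} (z : G) : RightQuotient H → RightQuotient H :=
  Quotient.map (fun w => w * z) fun w w' h => by
    have h' := QuotientGroup.rightRel_apply.mp h
    exact QuotientGroup.rightRel_apply.mpr (by simpa [mul_assoc] using h')

variable [TopologicalSpace G] [ChartedSpace (Coord n) G]

/-- `c` is a smooth local coordinate system on `Q = H \ G`, that is, a chart of the unique smooth
structure for which the projection `G → H \ G` is a smooth submersion. -/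
structure IsSmoothChart {H : Subgroup G}
    (c : OpenPartialHomeomorph (RightQuotient H) (Coord r)) : Prop where
  contMDiffOn : ContMDiffOn (𝓡 n) (𝓡 r) ∞ (fun z => c (proj H z)) (proj H ⁻¹' c.source)
  submersion : ∀ z, proj H z ∈ c.source →
    Function.Surjective (mfderiv (𝓡 n) (𝓡 r) (fun z' => c (proj H z')) z)

/-- The components `ζ_i^a(q)` of the infinitesimal generators of the action of `G` on `Q`, in the
chart `c`: the differential of `z ↦ ρ_z q` at the identity, applied to `e_i`. -/
def zeta {H : Subgroup G} (c : OpenPartialHomeomorph (RightQuotient H) (Coord r))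
    (b : Module.Basis (Fin n) ℝ (GroupLieAlgebra (𝓡 n) G)) (i : Fin n) (q : Coord r) : Coord r :=
  mfderiv (𝓡 n) (𝓡 r) (fun z : G => c (rho z (c.symm q))) 1 (b i)

/-- The functions `f_i(q, p; μ) = ζ_i^a(q) p_a + χ_i(q; μ)`. -/
def transition {H : Subgroup G} (c : OpenPartialHomeomorph (RightQuotient H) (Coord r))
    (b : Module.Basis (Fin n) ℝ (GroupLieAlgebra (𝓡 n) G))
    (χ : Fin n → Coord r → DualLie n G → ℝ) (μ : DualLie n G) (i : Fin n) (q p : Coord r) : ℝ :=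
  ∑ a, zeta c b i q a * p a + χ i q μ

variable {M : Type*} [TopologicalSpace M] [ChartedSpace (Coord n) M] [MulAction G M]

/-- The map `φ : M × Q → Q`, `φ(y, q) = ρ_z q` with `z = ψ⁻¹(y)`. -/
def phi {H : Subgroup G} (x₀ y : M) (q : RightQuotient H) : RightQuotient H :=
  rho (psiInv G x₀ y) q

/-- The map `φ` in the coordinates given by the charts `e` of `M` and `c` of `Q`. -/
def phiCoord {H : Subgroup G} (e : OpenPartialHomeomorph M (Coord n))
    (c : OpenPartialHomeomorph (RightQuotient H) (Coord r)) (x₀ : M)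
    (x : Coord n) (q : Coord r) : Coord r :=
  c (phi x₀ (e.symm x) (c.symm q))

/-- The left-hand side `𝐆^{ij} f_i(q, p; μ) f_j(q, p; μ)` of the reduced equation on `Q`. -/
def reducedSymbol [IsManifold (𝓡 n) ∞ M] {H : Subgroup G} (g : PseudoRiemannianMetric n M)
    (c : OpenPartialHomeomorph (RightQuotient H) (Coord r))
    (b : Module.Basis (Fin n) ℝ (GroupLieAlgebra (𝓡 n) G)) (x₀ : M)
    (χ : Fin n → Coord r → DualLie n G → ℝ) (μ : DualLie n G) (q p : Coord r) : ℝ :=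
  ∑ i, ∑ j, (gramMatrix g b x₀)⁻¹ i j * transition c b χ μ i q p * transition c b χ μ j q p

/-- The set of the `(x, q, j)` for which `x` and `q` are coordinates of points of the two chart
domains, `j ∈ J`, and `φ(x, q)` lies in the chart domain in `Q` again. -/
def formDomain {k : ℕ} {H : Subgroup G} (e : OpenPartialHomeomorph M (Coord n))
    (c : OpenPartialHomeomorph (RightQuotient H) (Coord r)) (x₀ : M) (J : Set (Coord k)) :
    Set (Coord n × Coord r × Coord k) :=
  {t | t.1 ∈ e.target ∧ t.2.1 ∈ c.target ∧ t.2.2 ∈ J ∧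
    phi x₀ (e.symm t.1) (c.symm t.2.1) ∈ c.source}

/-- `W(x; q, j) = ∫ χ_l(φ(x, q); lam j) ω^l(x)` on `D`: a function of class `C^N` whose differential
with respect to `x` is the 1-form `χ_l(φ(x, q); lam j) ω^l(x)`. -/
structure IsPrimitive {k : ℕ} {H : Subgroup G} (N : WithTop ℕ∞)
    (e : OpenPartialHomeomorph M (Coord n))
    (c : OpenPartialHomeomorph (RightQuotient H) (Coord r))
    (b : Module.Basis (Fin n) ℝ (GroupLieAlgebra (𝓡 n) G)) (x₀ : M)
    (χ : Fin n → Coord r → DualLie n G → ℝ) (lam : Coord k → DualLie n G)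
    (D : Set (Coord n × Coord r × Coord k)) (W : Coord n → Coord r → Coord k → ℝ) : Prop where
  isOpen : IsOpen D
  contDiffOn : ContDiffOn ℝ N (fun t : Coord n × Coord r × Coord k => W t.1 t.2.1 t.2.2) D
  differential : ∀ x q j, (x, q, j) ∈ D → ∀ i,
    partialDeriv (fun x' => W x' q j) i x
      = ∑ l, χ l (phiCoord e c x₀ x q) (lam j) * coframeMatrix e b x₀ x l i

end Homogeneous

end GeodesicHJ

end

/-! Everything rests on one identity: the derivative of S along the invariant field ξ_l is
f_l(φ(x,q), ∂S̃/∂q; λ(j)) (`fderiv_liftedIntegral`). Since ψ intertwines left translations with the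
action on M, and Q carries a right action, x ↦ φ(x,q) sends ξ_l to the generator ζ_l
(`fderiv_phiCoord_frameVector`). The term S̃ therefore contributes ζ_l^a ∂S̃/∂q^a, and the integral
contributes χ_l because the ω^l are dual to the ξ_l.

Equation. The group acts by isometries, so the metric has the constant components 𝐆_{kl} in the
frame, and the geodesic symbol of a covector p is 𝐆^{kl} p(ξ_k) p(ξ_l) (`geodesicSymbol_eq_sum`).
With p(ξ_k) = f_k this is the reduced equation at the point φ(x,q).

Existence of the integral. At p = 0 the bracket relations read ζ_i χ_l - ζ_l χ_i = C_{il}^s χ_s.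
Pulled back by φ and combined with [ξ_i, ξ_l] = C_{il}^s ξ_s (`lieBracket_frameVector`), they say
that χ_l ω^l is closed, by Cartan's formula on a frame (`fderiv_symm_of_frame`). Integration along
segments gives a primitive that is smooth in the parameters (`exists_contDiffOn_primitive`).

Nondegeneracy. ∂S/∂x is the image of (f_l) under the invertible coframe matrix, so α ↦ (f_l) has to
be an immersion. It is the composite of α ↦ (j, φ(x,q), ∂S̃/∂q), an immersion because ρ_z is
invertible and S̃ is complete (`eq_zero_of_fderiv_reducedPoint`), and (j,q,p) ↦ f(q,p; λ(j)), an
immersion because K recovers j and the rank along the orbit is 2r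
(`eq_zero_of_fderiv_transitionFamily`). Finally r + k + r = n.

The smoothness behind all this comes from two facts: ψ is a diffeomorphism (`contMDiff_psiInv`), and
G → H \ G has smooth local sections (`IsSmoothChart.exists_section`). -/

noncomputable section

namespace GeodesicHJ

open Set Filter Topology

set_option linter.unusedSectionVars false

/-! ### The orbit map ψ is an immersion. -/

section OrbitMap

variable {n : ℕ} {G : Type*} [TopologicalSpace G] [ChartedSpace (Coord n) G]
  {M : Type*} [TopologicalSpace M] [ChartedSpace (Coord n) M]

/-- A map with a differentiable left inverse has an injective differential. -/
theorem mfderiv_injective_of_leftInverse {d d' : ℕ}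
    {X : Type*} [TopologicalSpace X] [ChartedSpace (Coord d) X]
    {Y : Type*} [TopologicalSpace Y] [ChartedSpace (Coord d') Y]
    {f : X → Y} {h : Y → X} {x : X} (hf : MDifferentiableAt (𝓡 d) (𝓡 d') f x)
    (hh : MDifferentiableAt (𝓡 d') (𝓡 d) h (f x)) (hhf : ∀ᶠ x' in 𝓝 x, h (f x') = x') :
    Function.Injective (mfderiv (𝓡 d) (𝓡 d') f x) := by
  have h1 : mfderiv (𝓡 d) (𝓡 d) (h ∘ f) x = ContinuousLinearMap.id ℝ _ := by
    have h2 : h ∘ f =ᶠ[𝓝 x] id := hhf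
    rw [h2.mfderiv_eq, mfderiv_id]
  rw [mfderiv_comp x hh hf] at h1
  intro v w hvw
  have hv := congrArg (fun L => L v) h1
  have hw := congrArg (fun L => L w) h1
  have e1 : (mfderiv (𝓡 d') (𝓡 d) h (f x)) (mfderiv (𝓡 d) (𝓡 d') f x v) = v := hv
  have e2 : (mfderiv (𝓡 d') (𝓡 d) h (f x)) (mfderiv (𝓡 d) (𝓡 d') f x w) = w := hw
  rw [← e1, ← e2, hvw]

variable [Group G] [LieGroup (𝓡 n) ∞ G] [IsManifold (𝓡 n) ∞ M]
  [MulAction G M] [ContMDiffSMul (𝓡 n) (𝓡 n) ∞ G M]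

variable (G) in
theorem contMDiff_orbitMap (x₀ : M) :
    ContMDiff (𝓡 n) (𝓡 n) ∞ (fun z : G => z • x₀) :=
  (ContMDiffSMul.contMDiff_smul (I := 𝓡 n) (I' := 𝓡 n) (n := ∞) (G := G) (M := M)).comp
    (contMDiff_id.prodMk contMDiff_const)

theorem contMDiff_smul_left (z : G) :
    ContMDiff (𝓡 n) (𝓡 n) ∞ (fun y : M => z • y) :=
  (ContMDiffSMul.contMDiff_smul (I := 𝓡 n) (I' := 𝓡 n) (n := ∞) (G := G) (M := M)).comp
    (contMDiff_const.prodMk contMDiff_id)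

theorem mulInvariantVectorField_one (X : GroupLieAlgebra (𝓡 n) G) :
    mulInvariantVectorField (I := 𝓡 n) X (1 : G) = X := by
  have : mfderiv (𝓡 n) (𝓡 n) (fun w : G => 1 * w) 1 = ContinuousLinearMap.id ℝ _ := by
    have h : (fun w : G => 1 * w) = id := by ext; simp
    rw [h, mfderiv_id]
  have h2 := congrArg (fun L => L X) this
  exact h2

/-- Differentiate ψ(zw) = z • ψ(w) at w = 1. This turns questions about ψ at any point into
questions at the identity. -/
theorem mfderiv_orbitMap_mulInvariantVectorField (x₀ : M) (X : GroupLieAlgebra (𝓡 n) G) (z : G) :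
    mfderiv (𝓡 n) (𝓡 n) (fun z : G => z • x₀) z (mulInvariantVectorField (I := 𝓡 n) X z) =
      mfderiv (𝓡 n) (𝓡 n) (fun y : M => z • y) ((1 : G) • x₀)
        (mfderiv (𝓡 n) (𝓡 n) (fun z : G => z • x₀) 1 X) := by
  have h : (fun w : G => w • x₀) ∘ (fun w => z * w) = (fun y : M => z • y) ∘ fun w : G => w • x₀ := by
    ext w; simp [mul_smul]
  have h1 := mfderiv_comp (1 : G) (I := 𝓡 n) (I' := 𝓡 n) (I'' := 𝓡 n)
    (((contMDiff_orbitMap G x₀).mdifferentiable (by simp)) (z * 1))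
    ((contMDiff_mul_left (I := 𝓡 n) (n := ∞) (a := z)).mdifferentiable (by simp) (1 : G))
  have h2 := mfderiv_comp (1 : G) (I := 𝓡 n) (I' := 𝓡 n) (I'' := 𝓡 n)
    (((contMDiff_smul_left (M := M) z).mdifferentiable (by simp)) ((1 : G) • x₀))
    ((contMDiff_orbitMap G x₀).mdifferentiable (by simp) (1 : G))
  rw [h, h2] at h1
  have h3 := congrArg (fun L => L X) h1
  have h4 := mul_one z
  simp only [mulInvariantVectorField]
  refine Eq.trans ?_ h3.symm
  change _ = mfderiv (𝓡 n) (𝓡 n) (fun z : G => z • x₀) (z * 1) (mfderiv (𝓡 n) (𝓡 n) (fun w => z * w) 1 X)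
  rw [h4]

/-- By equivariance, if dψ kills X at the identity then it kills the left-invariant field of X
everywhere. Hence ψ is constant along an integral curve of that field; as ψ is injective, the curve
itself is constant and its velocity X vanishes. -/
theorem eq_zero_of_mfderiv_orbitMap_one (hst : SimplyTransitive G M) (x₀ : M)
    (X : GroupLieAlgebra (𝓡 n) G)
    (hX : mfderiv (𝓡 n) (𝓡 n) (fun z : G => z • x₀) 1 X = 0) : X = 0 := by
  obtain ⟨γ, hγ0, hγ⟩ := exists_isMIntegralCurveAt_of_contMDiffAt (I := 𝓡 n)
    (v := mulInvariantVectorField (I := 𝓡 n) X) (t₀ := 0) (x₀ := (1 : G))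
    ((contMDiffAt_mulInvariantVectorField X).of_le
      (by rw [minSmoothness_of_isRCLikeNormedField]; norm_num))
    BoundarylessManifold.isInteriorPoint
  set ψ : G → M := fun z => z • x₀ with hψ
  have hcomp : ∀ᶠ t in 𝓝 (0 : ℝ), HasMFDerivAt 𝓘(ℝ, ℝ) (𝓡 n) (ψ ∘ γ) t 0 := by
    filter_upwards [hγ] with t ht
    have h1 := (((contMDiff_orbitMap G x₀).mdifferentiable (by simp)) (γ t)).hasMFDerivAt.comp t ht
    have h2 := mfderiv_orbitMap_mulInvariantVectorField x₀ X (γ t)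
    rw [hX, map_zero] at h2
    have h3 : (mfderiv (𝓡 n) (𝓡 n) ψ (γ t)).comp ((1 : ℝ →L[ℝ] ℝ).smulRight
        (mulInvariantVectorField (I := 𝓡 n) X (γ t))) = 0 :=
      ContinuousLinearMap.ext_ring ((congrArg _ (one_smul ℝ _)).trans h2)
    exact h3 ▸ h1
  -- Constancy is deduced from a zero derivative in a chart, so the curve has to stay in one chart
  -- domain for a short time.
  have hsrc : ∀ᶠ t in 𝓝 (0 : ℝ), ψ (γ t) ∈ (chartAt (Coord n) (ψ 1)).source := by
    have hc : ContinuousAt (ψ ∘ γ) 0 := hcomp.self_of_nhds.continuousAt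
    refine hc.eventually_mem ((chartAt (Coord n) (ψ 1)).open_source.mem_nhds ?_)
    simp only [Function.comp_apply, hγ0]
    exact mem_chart_source _ _
  obtain ⟨ε, hε, hball⟩ := Metric.eventually_nhds_iff_ball.mp (hcomp.and hsrc)
  have hconst : ∀ t ∈ Metric.ball (0 : ℝ) ε,
      extChartAt (𝓡 n) (ψ 1) (ψ (γ t)) = extChartAt (𝓡 n) (ψ 1) (ψ (γ 0)) := by
    intro t ht
    have hder : ∀ s ∈ Metric.ball (0 : ℝ) ε,
        HasFDerivAt (fun s => extChartAt (𝓡 n) (ψ 1) (ψ (γ s))) (0 : ℝ →L[ℝ] Coord n) s := by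
      intro s hs
      have h1 := (mdifferentiableAt_extChartAt (I := 𝓡 n) (hball s hs).2).hasMFDerivAt.comp s
        (hball s hs).1
      rw [ContinuousLinearMap.comp_zero] at h1
      exact hasMFDerivAt_iff_hasFDerivAt.mp h1
    exact (Metric.isOpen_ball).is_const_of_fderiv_eq_zero
      (Metric.isConnected_ball hε).isPreconnected
      (fun s hs => (hder s hs).differentiableAt.differentiableWithinAt)
      (fun s hs => (hder s hs).fderiv) ht (Metric.mem_ball_self hε)
  have hγ1 : γ =ᶠ[𝓝 0] fun _ => (1 : G) := by
    filter_upwards [Metric.ball_mem_nhds (0 : ℝ) hε] with t ht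
    have h0 := (hball 0 (Metric.mem_ball_self hε)).2
    have h1 := (extChartAt (𝓡 n) (ψ 1)).injOn (by simpa using (hball t ht).2) (by simpa using h0)
      (hconst t ht)
    rw [hγ0] at h1
    exact (hst x₀ (ψ 1)).unique h1 rfl
  have h0 := hγ.self_of_nhds.mfderiv
  rw [hγ1.mfderiv_eq, mfderiv_const] at h0
  have h2 := congrArg (fun L => L (1 : ℝ)) h0
  have h3 : mulInvariantVectorField (I := 𝓡 n) X (γ 0) = 0 := by
    refine Eq.trans (one_smul ℝ _).symm ?_
    exact h2.symm
  have h4 : γ 0 = 1 := hγ0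
  rw [h4, mulInvariantVectorField_one] at h3
  exact h3

theorem mfderiv_mul_left_injective (z : G) :
    Function.Injective (mfderiv (𝓡 n) (𝓡 n) (fun w : G => z * w) 1) :=
  mfderiv_injective_of_leftInverse (h := fun w => z⁻¹ * w)
    ((contMDiff_mul_left (I := 𝓡 n) (n := ∞)).mdifferentiable (by simp) _)
    ((contMDiff_mul_left (I := 𝓡 n) (n := ∞)).mdifferentiable (by simp) _) (by simp)

theorem mfderiv_orbitMap_injective (hst : SimplyTransitive G M) (x₀ : M) (z : G) :
    Function.Injective (mfderiv (𝓡 n) (𝓡 n) (fun z : G => z • x₀) z) := by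
  rw [injective_iff_map_eq_zero]
  intro w hw
  -- Left translation has an injective differential between spaces of equal dimension, so every
  -- tangent vector at z is the value of a left-invariant field.
  obtain ⟨X, rfl⟩ : ∃ X : GroupLieAlgebra (𝓡 n) G, mulInvariantVectorField (I := 𝓡 n) X z = w := by
    have hsurj := (LinearMap.injective_iff_surjective
      (f := ((show Coord n →L[ℝ] Coord n from mfderiv (𝓡 n) (𝓡 n) (fun w : G => z * w) 1) :
        Coord n →ₗ[ℝ] Coord n))).mp (mfderiv_mul_left_injective z)
    exact hsurj w
  rw [mfderiv_orbitMap_mulInvariantVectorField] at hw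
  have hinj : Function.Injective (mfderiv (𝓡 n) (𝓡 n) (fun y : M => z • y) ((1 : G) • x₀)) :=
    mfderiv_injective_of_leftInverse (h := fun y => z⁻¹ • y)
      ((contMDiff_smul_left z).mdifferentiable (by simp) _)
      ((contMDiff_smul_left z⁻¹).mdifferentiable (by simp) _) (by simp)
  have hX := eq_zero_of_mfderiv_orbitMap_one hst x₀ X (hinj (hw.trans (map_zero _).symm))
  subst hX
  exact map_zero (mfderiv (𝓡 n) (𝓡 n) (fun w : G => z * w) 1)

end OrbitMap

/-- An injective endomorphism of a finite-dimensional space, as a continuous linear equivalence. -/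
theorem exists_equiv_of_injective {d : ℕ} (L : Coord d →L[ℝ] Coord d)
    (hL : Function.Injective L) : ∃ L' : Coord d ≃L[ℝ] Coord d, (L' : Coord d →L[ℝ] Coord d) = L :=
  ⟨(LinearEquiv.ofInjectiveEndo (L : Coord d →ₗ[ℝ] Coord d) hL).toContinuousLinearEquiv, by
    ext v; rfl⟩

/-! ### The inverse function theorem on manifolds. -/

section InverseFunction

variable {n : ℕ} {X : Type*} [TopologicalSpace X] [ChartedSpace (Coord n) X]
  [IsManifold (𝓡 n) ∞ X] {Y : Type*} [TopologicalSpace Y] [ChartedSpace (Coord n) Y]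
  [IsManifold (𝓡 n) ∞ Y]

/-- A left inverse of a local diffeomorphism is smooth. -/
theorem contMDiffAt_of_leftInverse {f : X → Y} {h : Y → X} {x : X}
    (hf : ContMDiffAt (𝓡 n) (𝓡 n) ∞ f x)
    (hinj : Function.Injective (mfderiv (𝓡 n) (𝓡 n) f x)) (hh : ∀ x', h (f x') = x') :
    ContMDiffAt (𝓡 n) (𝓡 n) ∞ h (f x) := by
  set a := extChartAt (𝓡 n) x with ha
  set c := extChartAt (𝓡 n) (f x) with hc
  have hF := (contMDiffAt_iff.mp hf).2
  rw [ModelWithCorners.range_eq_univ, contDiffWithinAt_univ] at hF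
  have hder : HasFDerivAt (c ∘ f ∘ a.symm) (mfderiv (𝓡 n) (𝓡 n) f x) (a x) := by
    have h1 := (hf.mdifferentiableAt (by simp)).hasMFDerivAt.2
    rw [ModelWithCorners.range_eq_univ] at h1
    exact hasFDerivWithinAt_univ.mp h1
  obtain ⟨L, hL⟩ := exists_equiv_of_injective (d := n) (mfderiv (𝓡 n) (𝓡 n) f x) hinj
  have hder' : HasFDerivAt (c ∘ f ∘ a.symm) (L : Coord n →L[ℝ] Coord n) (a x) := by
    rw [hL]; exact hder
  have hstrict := hF.hasStrictFDerivAt' hder' (by simp)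
  have hgsm := hF.to_localInverse hder' (by simp)
  -- The smooth candidate for h near `f x` is `a.symm ∘ k ∘ c`, with k the local inverse of f in
  -- charts.
  set k := hF.localInverse hder' (by simp) with hk
  have hkpt : k ((c ∘ f ∘ a.symm) (a x)) = a x := hF.localInverse_apply_image hder' (by simp)
  have hright : ∀ᶠ y in 𝓝 ((c ∘ f ∘ a.symm) (a x)), (c ∘ f ∘ a.symm) (k y) = y :=
    hstrict.eventually_right_inverse
  have hpt : (c ∘ f ∘ a.symm) (a x) = c (f x) := by
    simp [ha]
  rw [hpt] at hgsm hkpt hright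
  have hasm : ContMDiffAt 𝓘(ℝ, Coord n) (𝓡 n) ∞ a.symm (a x) :=
    (contMDiffOn_extChartAt_symm (I := 𝓡 n) x).contMDiffAt (extChartAt_target_mem_nhds x)
  have hcsm : ContMDiffAt (𝓡 n) 𝓘(ℝ, Coord n) ∞ c (f x) := contMDiffAt_extChartAt
  have hkc : ContMDiffAt (𝓡 n) 𝓘(ℝ, Coord n) ∞ (k ∘ c) (f x) :=
    hgsm.contMDiffAt.comp (f x) hcsm
  have hkc0 : (k ∘ c) (f x) = a x := hkpt
  have hloc : ContMDiffAt (𝓡 n) (𝓡 n) ∞ (a.symm ∘ (k ∘ c)) (f x) :=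
    ContMDiffAt.comp (f x) (by rw [hkc0]; exact hasm) hkc
  refine hloc.congr_of_eventuallyEq ?_
  have hval : (a.symm ∘ (k ∘ c)) (f x) = x := by
    simp only [Function.comp_apply] at hkc0 ⊢
    rw [hkc0]; simp [ha]
  have e1 : ∀ᶠ y in 𝓝 (f x), y ∈ c.source := extChartAt_source_mem_nhds (f x)
  have e2 : ∀ᶠ y in 𝓝 (f x), f ((a.symm ∘ (k ∘ c)) y) ∈ c.source := by
    have hcont : ContinuousAt (fun y => f ((a.symm ∘ (k ∘ c)) y)) (f x) :=
      ContinuousAt.comp (g := f) (by rw [hval]; exact hf.continuousAt) hloc.continuousAt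
    refine hcont.eventually_mem ?_
    rw [hval]
    exact extChartAt_source_mem_nhds (f x)
  have e3 : ∀ᶠ y in 𝓝 (f x), (c ∘ f ∘ a.symm) (k (c y)) = c y :=
    hcsm.continuousAt.eventually hright
  filter_upwards [e1, e2, e3] with y h1 h2 h3
  -- The candidate is a right inverse of f near `f x`; applying h to this equation identifies it
  -- with h, for which not even continuity was assumed.
  have h4 : f ((a.symm ∘ (k ∘ c)) y) = y := c.injOn h2 h1 h3
  rw [← h4, hh, h4]

end InverseFunction

/-! ### ψ is a diffeomorphism. -/

section Frame

variable {n : ℕ} {G : Type*} [TopologicalSpace G] [ChartedSpace (Coord n) G]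
  {M : Type*} [TopologicalSpace M] [ChartedSpace (Coord n) M]
  [Group G] [LieGroup (𝓡 n) ∞ G] [IsManifold (𝓡 n) ∞ M]
  [MulAction G M] [ContMDiffSMul (𝓡 n) (𝓡 n) ∞ G M]

theorem SimplyTransitive.bijective (hst : SimplyTransitive G M) (x₀ : M) :
    Function.Bijective fun z : G => z • x₀ :=
  ⟨fun _ z' h => (hst x₀ (z' • x₀)).unique h rfl, fun y => (hst x₀ y).exists⟩

theorem psiInv_smul (hst : SimplyTransitive G M) (x₀ : M) (z : G) : psiInv G x₀ (z • x₀) = z :=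
  Function.leftInverse_invFun (hst.bijective x₀).1 z

theorem smul_psiInv (hst : SimplyTransitive G M) (x₀ y : M) : psiInv G x₀ y • x₀ = y :=
  Function.rightInverse_invFun (hst.bijective x₀).2 y

theorem contMDiff_psiInv (hst : SimplyTransitive G M) (x₀ : M) :
    ContMDiff (𝓡 n) (𝓡 n) ∞ (psiInv G x₀ : M → G) := by
  intro y
  obtain ⟨z, rfl⟩ := (hst.bijective x₀).2 y
  have : IsManifold (𝓡 n) ∞ G := ContMDiffMul.toIsManifold
  exact contMDiffAt_of_leftInverse (contMDiff_orbitMap G x₀ z) (mfderiv_orbitMap_injective hst x₀ z)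
    (psiInv_smul hst x₀)

end Frame

/-! ### The invariant frame in coordinates: independence, smoothness, brackets, metric. -/

section Frame

variable {n : ℕ} {G : Type*} [TopologicalSpace G] [ChartedSpace (Coord n) G]
  {M : Type*} [TopologicalSpace M] [ChartedSpace (Coord n) M]
  [Group G] [LieGroup (𝓡 n) ∞ G] [IsManifold (𝓡 n) ∞ M]
  [MulAction G M] [ContMDiffSMul (𝓡 n) (𝓡 n) ∞ G M]

variable (G) in
/-- The map `ψ⁻¹`, in the chart `e` of `M`. -/
def groupPoint (e : OpenPartialHomeomorph M (Coord n)) (x₀ : M) (x : Coord n) : G :=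
  psiInv G x₀ (e.symm x)

/-- The field `ξ_k`, in the chart `e` of `M`. -/
def frameVector (e : OpenPartialHomeomorph M (Coord n))
    (b : Module.Basis (Fin n) ℝ (GroupLieAlgebra (𝓡 n) G)) (x₀ : M) (k : Fin n) (x : Coord n) :
    Coord n :=
  mfderiv (𝓡 n) (𝓡 n) e (e.symm x) (xi b x₀ k (e.symm x))

theorem frameMatrix_apply (e : OpenPartialHomeomorph M (Coord n))
    (b : Module.Basis (Fin n) ℝ (GroupLieAlgebra (𝓡 n) G)) (x₀ : M) (x : Coord n) (i k : Fin n) :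
    frameMatrix e b x₀ x i k = frameVector e b x₀ k x i := rfl

variable {e : OpenPartialHomeomorph M (Coord n)}

theorem smul_groupPoint (hst : SimplyTransitive G M) (x₀ : M) (x : Coord n) :
    groupPoint G e x₀ x • x₀ = e.symm x := smul_psiInv hst x₀ _

theorem contMDiffAt_chart (he : e ∈ IsManifold.maximalAtlas (𝓡 n) ∞ M) {y : M}
    (hy : y ∈ e.source) : ContMDiffAt (𝓡 n) (𝓡 n) ∞ e y :=
  (contMDiffOn_of_mem_maximalAtlas he).contMDiffAt (e.open_source.mem_nhds hy)

theorem contMDiffAt_chart_symm (he : e ∈ IsManifold.maximalAtlas (𝓡 n) ∞ M) {x : Coord n}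
    (hx : x ∈ e.target) : ContMDiffAt (𝓡 n) (𝓡 n) ∞ e.symm x :=
  (contMDiffOn_symm_of_mem_maximalAtlas he).contMDiffAt (e.open_target.mem_nhds hx)

variable (hst : SimplyTransitive G M) (he : e ∈ IsManifold.maximalAtlas (𝓡 n) ∞ M) (x₀ : M)
  (b : Module.Basis (Fin n) ℝ (GroupLieAlgebra (𝓡 n) G))

include hst he in
theorem contMDiffAt_groupPoint {x : Coord n} (hx : x ∈ e.target) :
    ContMDiffAt (𝓡 n) (𝓡 n) ∞ (groupPoint G e x₀) x :=
  (contMDiff_psiInv hst x₀ _).comp x (contMDiffAt_chart_symm he hx)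

include hst he in
theorem mfderiv_groupPoint_injective {x : Coord n} (hx : x ∈ e.target) :
    Function.Injective (mfderiv (𝓡 n) (𝓡 n) (groupPoint G e x₀) x) := by
  refine mfderiv_injective_of_leftInverse (h := fun z : G => e (z • x₀))
    ((contMDiffAt_groupPoint hst he x₀ hx).mdifferentiableAt (by simp)) ?_ ?_
  · refine MDifferentiableAt.comp (g := e) _ ?_
      ((contMDiff_orbitMap G x₀).mdifferentiable (by simp) _)
    rw [smul_groupPoint hst]
    exact (contMDiffAt_chart he (e.map_target hx)).mdifferentiableAt (by simp)
  · filter_upwards [e.open_target.mem_nhds hx] with x' hx'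
    rw [smul_groupPoint hst, e.right_inv hx']

include hst he in
-- In a chart, ψ⁻¹ followed after ψ is the identity; its derivative, applied to a left-invariant
-- vector, gives the claim. Through this relation the frame inherits its properties from the
-- left-invariant fields on G.
theorem mfderiv_groupPoint_frameVector {x : Coord n} (hx : x ∈ e.target) (k : Fin n) :
    mfderiv (𝓡 n) (𝓡 n) (groupPoint G e x₀) x (frameVector e b x₀ k x) =
      mulInvariantVectorField (I := 𝓡 n) (b k) (groupPoint G e x₀ x) := by
  set z := groupPoint G e x₀ x with hz
  have hzx : z • x₀ = e.symm x := smul_groupPoint hst x₀ x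
  have hψ := ((contMDiff_orbitMap (n := n) G x₀).mdifferentiable (by simp) z).hasMFDerivAt
  have hchart : HasMFDerivAt (𝓡 n) (𝓡 n) e (z • x₀)
      (show Coord n →L[ℝ] Coord n from mfderiv (𝓡 n) (𝓡 n) e (e.symm x)) := by
    rw [hzx]
    exact ((contMDiffAt_chart he (e.map_target hx)).mdifferentiableAt (by simp)).hasMFDerivAt
  have hu : HasMFDerivAt (𝓡 n) (𝓡 n) (groupPoint G e x₀) (e (z • x₀))
      (show Coord n →L[ℝ] Coord n from mfderiv (𝓡 n) (𝓡 n) (groupPoint G e x₀) x) := by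
    rw [hzx, e.right_inv hx]
    exact ((contMDiffAt_groupPoint hst he x₀ hx).mdifferentiableAt (by simp)).hasMFDerivAt
  have hcomp := (hu.comp (z • x₀) hchart).comp z hψ
  have hid : ((groupPoint G e x₀ ∘ e) ∘ fun z : G => z • x₀) =ᶠ[𝓝 z] id := by
    have hc : ContinuousAt (fun z : G => z • x₀) z := hψ.continuousAt
    filter_upwards [hc.eventually_mem (e.open_source.mem_nhds (by rw [hzx]; exact e.map_target hx))]
      with w hw
    simp [groupPoint, e.left_inv hw, psiInv_smul hst]
  have h1 := hcomp.mfderiv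
  rw [hid.mfderiv_eq, mfderiv_id] at h1
  exact (congrArg (fun L => L (mulInvariantVectorField (I := 𝓡 n) (b k) z)) h1).symm


include hst he in
theorem exists_equiv_mfderiv_groupPoint {x : Coord n} (hx : x ∈ e.target) :
    ∃ L : Coord n ≃L[ℝ] Coord n,
      (L : Coord n →L[ℝ] Coord n) = mfderiv (𝓡 n) (𝓡 n) (groupPoint G e x₀) x :=
  exists_equiv_of_injective (mfderiv (𝓡 n) (𝓡 n) (groupPoint G e x₀) x)
    (mfderiv_groupPoint_injective hst he x₀ hx)

include hst he in
-- The differential of ψ⁻¹ carries the combination to the left translate of ∑ a_k e_k, and left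
-- translation is injective on tangent vectors.
theorem frameVector_sum_eq_zero {x : Coord n} (hx : x ∈ e.target) {a : Fin n → ℝ}
    (ha : ∑ k, a k • frameVector e b x₀ k x = 0) : a = 0 := by
  have h1 := congrArg (fun v : Coord n => (show Coord n from
    mfderiv (𝓡 n) (𝓡 n) (groupPoint G e x₀) x v)) ha
  have h2 : mfderiv (𝓡 n) (𝓡 n) (fun w : G => groupPoint G e x₀ x * w) 1 (∑ k, a k • b k) = 0 := by
    rw [map_sum]
    refine Eq.trans ?_ (h1.trans (map_zero (mfderiv (𝓡 n) (𝓡 n) (groupPoint G e x₀) x)))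
    refine Eq.trans ?_ (map_sum (mfderiv (𝓡 n) (𝓡 n) (groupPoint G e x₀) x) _ _).symm
    refine Finset.sum_congr rfl fun k _ => ?_
    refine Eq.trans ?_ (map_smul (mfderiv (𝓡 n) (𝓡 n) (groupPoint G e x₀) x) (a k) _).symm
    rw [mfderiv_groupPoint_frameVector hst he x₀ b hx k]
    exact map_smul _ _ _
  have h3 : ∑ k, a k • b k = 0 :=
    mfderiv_mul_left_injective (groupPoint G e x₀ x) (h2.trans (map_zero _).symm)
  exact funext fun k => (Fintype.linearIndependent_iff.mp b.linearIndependent) a h3 k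

include hst he in
theorem frameMatrix_det_ne_zero {x : Coord n} (hx : x ∈ e.target) :
    (frameMatrix e b x₀ x).det ≠ 0 := by
  intro h
  obtain ⟨a, ha0, ha⟩ := Matrix.exists_mulVec_eq_zero_iff.mpr h
  refine ha0 (frameVector_sum_eq_zero hst he x₀ b hx ?_)
  ext i
  have := congrFun ha i
  simp only [Matrix.mulVec, dotProduct, frameMatrix_apply, Pi.zero_apply] at this
  simpa [mul_comm] using this

include hst he in
theorem coframeMatrix_mul_frameMatrix {x : Coord n} (hx : x ∈ e.target) :
    coframeMatrix e b x₀ x * frameMatrix e b x₀ x = 1 :=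
  Matrix.nonsing_inv_mul _ (frameMatrix_det_ne_zero hst he x₀ b hx).isUnit

include hst he in
theorem frameMatrix_mul_coframeMatrix {x : Coord n} (hx : x ∈ e.target) :
    frameMatrix e b x₀ x * coframeMatrix e b x₀ x = 1 :=
  Matrix.mul_nonsing_inv _ (frameMatrix_det_ne_zero hst he x₀ b hx).isUnit

/-- The action on the point `x₀`, in the chart `e` of `M` and the chart of `G` at the identity. -/
def frameFlow (e : OpenPartialHomeomorph M (Coord n)) (x₀ : M) (x s : Coord n) : Coord n :=
  e (groupPoint G e x₀ x • (extChartAt (𝓡 n) (1 : G)).symm s • x₀)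

include hst he in
theorem contDiffAt_frameFlow {x : Coord n} (hx : x ∈ e.target) :
    ContDiffAt ℝ ∞ (Function.uncurry (frameFlow (G := G) e x₀))
      (x, extChartAt (𝓡 n) (1 : G) 1) := by
  set s₀ := extChartAt (𝓡 n) (1 : G) 1
  have hs : (extChartAt (𝓡 n) (1 : G)).symm s₀ = 1 := by simp [s₀]
  have h1 : ContMDiffAt (𝓘(ℝ, Coord n × Coord n)) (𝓡 n) ∞
      (fun t : Coord n × Coord n => groupPoint G e x₀ t.1) (x, s₀) :=
    ContMDiffAt.comp (I' := 𝓡 n) (g := groupPoint G e x₀) (f := Prod.fst) (x, s₀)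
      (contMDiffAt_groupPoint hst he x₀ hx)
      contDiff_fst.contMDiff.contMDiffAt
  have h2 : ContMDiffAt (𝓘(ℝ, Coord n × Coord n)) (𝓡 n) ∞
      (fun t : Coord n × Coord n => (extChartAt (𝓡 n) (1 : G)).symm t.2) (x, s₀) := by
    have : IsManifold (𝓡 n) ∞ G := ContMDiffMul.toIsManifold
    exact ContMDiffAt.comp (I' := 𝓡 n) (g := (extChartAt (𝓡 n) (1 : G)).symm) (f := Prod.snd) (x, s₀)
      ((contMDiffOn_extChartAt_symm (I := 𝓡 n) (1 : G)).contMDiffAt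
        (show _ ∈ 𝓝 s₀ from extChartAt_target_mem_nhds (1 : G)))
      contDiff_snd.contMDiff.contMDiffAt
  have hsm := ContMDiffSMul.contMDiff_smul (I := 𝓡 n) (I' := 𝓡 n) (n := ∞) (G := G) (M := M)
  have h3 : ContMDiffAt (𝓘(ℝ, Coord n × Coord n)) (𝓡 n) ∞ (fun t : Coord n × Coord n =>
      groupPoint G e x₀ t.1 • (extChartAt (𝓡 n) (1 : G)).symm t.2 • x₀) (x, s₀) :=
    ContMDiffAt.comp (x, s₀) hsm.contMDiffAt
      (h1.prodMk (ContMDiffAt.comp (x, s₀) hsm.contMDiffAt (h2.prodMk contMDiffAt_const)))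
  refine ContMDiffAt.contDiffAt (ContMDiffAt.comp (g := e) (x, s₀) ?_ h3)
  simp only [hs, one_smul, smul_groupPoint hst]
  exact contMDiffAt_chart he (e.map_target hx)

include hst he in
-- The left-invariant vector at z is the velocity of z·s as s leaves the identity. In this form the
-- frame is a partial derivative of a jointly smooth map, which makes its smoothness in x visible.
theorem frameVector_eq_fderiv_frameFlow {x : Coord n} (hx : x ∈ e.target) (k : Fin n) :
    frameVector e b x₀ k x =
      fderiv ℝ (frameFlow (G := G) e x₀ x) (extChartAt (𝓡 n) (1 : G) 1) (b k) := by
  set z := groupPoint G e x₀ x with hz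
  have hzx : z • x₀ = e.symm x := smul_groupPoint hst x₀ x
  have hL := ((contMDiff_mul_left (I := 𝓡 n) (n := ∞) (a := z)).mdifferentiable
    (by simp) 1).hasMFDerivAt
  have hψ : HasMFDerivAt (𝓡 n) (𝓡 n) (fun z : G => z • x₀) (z * 1)
      (show Coord n →L[ℝ] Coord n from mfderiv (𝓡 n) (𝓡 n) (fun z : G => z • x₀) z) := by
    rw [mul_one]
    exact ((contMDiff_orbitMap (n := n) G x₀).mdifferentiable (by simp) z).hasMFDerivAt
  have hchart : HasMFDerivAt (𝓡 n) (𝓡 n) e ((z * 1) • x₀)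
      (show Coord n →L[ℝ] Coord n from mfderiv (𝓡 n) (𝓡 n) e (e.symm x)) := by
    rw [mul_one, hzx]
    exact ((contMDiffAt_chart he (e.map_target hx)).mdifferentiableAt (by simp)).hasMFDerivAt
  have hcomp := (hchart.comp (z * 1) hψ).comp 1 hL
  have h2 := hcomp.2
  rw [ModelWithCorners.range_eq_univ] at h2
  have h3 : HasFDerivAt (frameFlow (G := G) e x₀ x)
      ((show Coord n →L[ℝ] Coord n from mfderiv (𝓡 n) (𝓡 n) e (e.symm x)).comp
        ((show Coord n →L[ℝ] Coord n from mfderiv (𝓡 n) (𝓡 n) (fun z : G => z • x₀) z).comp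
          (show Coord n →L[ℝ] Coord n from mfderiv (𝓡 n) (𝓡 n) (fun w : G => z * w) 1)))
      (extChartAt (𝓡 n) (1 : G) 1) := by
    refine (hasFDerivWithinAt_univ.mp h2).congr_of_eventuallyEq (.of_forall fun s => ?_)
    simp [frameFlow, writtenInExtChartAt, hz, mul_smul]
    rfl
  rw [h3.fderiv]
  rfl

include hst he in
theorem contDiffOn_frameVector (k : Fin n) :
    ContDiffOn ℝ ∞ (frameVector e b x₀ k) e.target := by
  intro x hx
  refine ContDiffAt.contDiffWithinAt ?_
  have h1 : ContDiffAt ℝ ∞ (fun x => fderiv ℝ (frameFlow (G := G) e x₀ x)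
      (extChartAt (𝓡 n) (1 : G) 1) (b k)) x :=
    ((contDiffAt_frameFlow hst he x₀ hx).fderiv (m := ∞) (g := fun _ => _)
      contDiffAt_const (by simp)).clm_apply contDiffAt_const
  refine h1.congr_of_eventuallyEq ?_
  filter_upwards [e.open_target.mem_nhds hx] with x' hx'
  exact frameVector_eq_fderiv_frameFlow hst he x₀ b hx' k

theorem contDiffOn_matrix_det {E : Type*} [NormedAddCommGroup E] [NormedSpace ℝ E] {ι : Type*}
    [Fintype ι] [DecidableEq ι] {N : WithTop ℕ∞} {A : E → Matrix ι ι ℝ} {s : Set E}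
    (hA : ∀ i j, ContDiffOn ℝ N (fun x => A x i j) s) : ContDiffOn ℝ N (fun x => (A x).det) s := by
  simp only [Matrix.det_apply']
  exact ContDiffOn.sum fun σ _ => contDiffOn_const.mul (contDiffOn_prod fun i _ => hA _ _)

theorem contDiffOn_matrix_inv {E : Type*} [NormedAddCommGroup E] [NormedSpace ℝ E] {ι : Type*}
    [Fintype ι] [DecidableEq ι] {N : WithTop ℕ∞} {A : E → Matrix ι ι ℝ} {s : Set E}
    (hA : ∀ i j, ContDiffOn ℝ N (fun x => A x i j) s) (hdet : ∀ x ∈ s, (A x).det ≠ 0) (i j : ι) :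
    ContDiffOn ℝ N (fun x => (A x)⁻¹ i j) s := by
  -- Cramer's rule: the entries of the inverse are quotients of determinants.
  have h : ∀ x ∈ s, (A x)⁻¹ i j = ((A x).det)⁻¹ * ((A x).updateRow j (Pi.single i 1)).det := by
    intro x _
    rw [Matrix.inv_def, Matrix.smul_apply, Matrix.adjugate_apply, Ring.inverse_eq_inv', smul_eq_mul]
  refine ContDiffOn.congr ?_ h
  refine ((contDiffOn_matrix_det hA).inv hdet).mul (contDiffOn_matrix_det fun i' j' => ?_)
  by_cases hij : i' = j
  · subst hij
    simpa using contDiffOn_const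
  · simpa [Matrix.updateRow_ne hij] using hA i' j'

include hst he in
theorem contDiffOn_coframeMatrix (i j : Fin n) :
    ContDiffOn ℝ ∞ (fun x => coframeMatrix e b x₀ x i j) e.target := by
  refine contDiffOn_matrix_inv (fun i j => ?_)
    (fun x hx => frameMatrix_det_ne_zero hst he x₀ b hx) i j
  simp only [frameMatrix_apply]
  exact (EuclideanSpace.proj (𝕜 := ℝ) i).contDiff.comp_contDiffOn
    (contDiffOn_frameVector hst he x₀ b j)

theorem mlieBracket_eq_fderiv_sub_fderiv {E : Type*} [NormedAddCommGroup E] [NormedSpace ℝ E]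
    (V W : E → E) (x : E) :
    VectorField.mlieBracket 𝓘(ℝ, E) V W x = fderiv ℝ W x (V x) - fderiv ℝ V x (W x) := by
  have h : VectorField.mlieBracketWithin 𝓘(ℝ, E) V W univ = VectorField.lieBracketWithin ℝ V W univ :=
    VectorField.mlieBracketWithin_eq_lieBracketWithin
  rw [VectorField.lieBracketWithin_univ] at h
  exact congrFun ((VectorField.mlieBracketWithin_univ).symm.trans h) x

include hst he in
-- The ξ_k are the pullbacks by ψ⁻¹ of left-invariant fields. Pullback commutes with brackets, and
-- the bracket of two left-invariant fields is the left-invariant field of the Lie algebra bracket.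
theorem lieBracket_frameVector {x : Coord n} (hx : x ∈ e.target) (i j : Fin n) :
    fderiv ℝ (frameVector e b x₀ j) x (frameVector e b x₀ i x) -
      fderiv ℝ (frameVector e b x₀ i) x (frameVector e b x₀ j x) =
      ∑ l, b.repr ⁅b i, b j⁆ l • frameVector e b x₀ l x := by
  -- The pullback is defined by inverting the differential of ψ⁻¹, which is legitimate because that
  -- differential is an isomorphism.
  have key : ∀ X : GroupLieAlgebra (𝓡 n) G, ∀ x' ∈ e.target,
      VectorField.mpullback (𝓡 n) (𝓡 n) (groupPoint G e x₀) (mulInvariantVectorField (I := 𝓡 n) X) x'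
        = ∑ l, b.repr X l • frameVector e b x₀ l x' := by
    intro X x' hx'
    obtain ⟨L, hL⟩ := exists_equiv_mfderiv_groupPoint hst he x₀ hx'
    have h1 : L (∑ l, b.repr X l • frameVector e b x₀ l x') =
        mulInvariantVectorField (I := 𝓡 n) X (groupPoint G e x₀ x') := by
      have h2 : ∀ l, L (frameVector e b x₀ l x') =
          mulInvariantVectorField (I := 𝓡 n) (b l) (groupPoint G e x₀ x') := fun l =>
        (congrArg (fun T : Coord n →L[ℝ] Coord n => T (frameVector e b x₀ l x')) hL).trans
          (mfderiv_groupPoint_frameVector hst he x₀ b hx' l)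
      rw [map_sum]
      simp only [map_smul, h2]
      conv_rhs => rw [← b.sum_repr X]
      simp only [mulInvariantVectorField]
      rw [map_sum]
      refine Finset.sum_congr rfl fun l _ => ?_
      exact (map_smul _ _ _).symm
    have h3 : (ContinuousLinearMap.inverse (L : Coord n →L[ℝ] Coord n))
        (mulInvariantVectorField (I := 𝓡 n) X (groupPoint G e x₀ x')) =
          ∑ l, b.repr X l • frameVector e b x₀ l x' := by
      rw [ContinuousLinearMap.inverse_equiv, ← h1]
      exact L.symm_apply_apply _
    rw [hL] at h3
    exact h3
  have hfr : ∀ k, VectorField.mpullback (𝓡 n) (𝓡 n) (groupPoint G e x₀)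
      (mulInvariantVectorField (I := 𝓡 n) (b k)) =ᶠ[𝓝 x] frameVector e b x₀ k := by
    intro k
    filter_upwards [e.open_target.mem_nhds hx] with x' hx'
    rw [key _ x' hx', Finset.sum_eq_single k]
    · simp
    · intro l _ hl
      simp [hl.symm]
    · simp
  have hbr := VectorField.mpullback_mlieBracket (I := 𝓡 n) (I' := 𝓡 n) (x₀ := x) (n := ∞)
    (mdifferentiableAt_mulInvariantVectorField (b i))
    (mdifferentiableAt_mulInvariantVectorField (b j))
    (contMDiffAt_groupPoint hst he x₀ hx)
    (by rw [minSmoothness_of_isRCLikeNormedField]; exact ENat.LEInfty.out)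
  rw [← mulInvariantVector_mlieBracket, ← GroupLieAlgebra.bracket_def, key _ x hx,
    (hfr i).mlieBracket_vectorField_eq (hfr j)] at hbr
  refine Eq.trans ?_ hbr.symm
  exact (mlieBracket_eq_fderiv_sub_fderiv _ _ x).symm


include hst in
-- ξ_k at z • x₀ is the translate by z of its value at x₀, and z acts by an isometry.
theorem val_xi_xi {g : PseudoRiemannianMetric n M} (hG : ActsByIsometries G g) (y : M)
    (k l : Fin n) : g.val y (xi b x₀ k y) (xi b x₀ l y) = gramMatrix g b x₀ k l := by
  -- The point is generalized so that the equation y = z • 1 • x₀ can be substituted inside the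
  -- tangent spaces.
  have key : ∀ (z : G) (y : M), psiInv G x₀ y = z → y = z • (1 : G) • x₀ →
      g.val y (xi b x₀ k y) (xi b x₀ l y) = gramMatrix g b x₀ k l := by
    rintro z y hz rfl
    simp only [xi]
    rw [hz]
    have h := fun k => mfderiv_orbitMap_mulInvariantVectorField (M := M) x₀ (b k) z
    have h' := hG z ((1 : G) • x₀) (mfderiv (𝓡 n) (𝓡 n) (fun z : G => z • x₀) 1 (b k))
      (mfderiv (𝓡 n) (𝓡 n) (fun z : G => z • x₀) 1 (b l))
    rw [← h k, ← h l] at h'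
    exact h'
  exact key _ y rfl (by rw [one_smul, smul_psiInv hst])

include hst he in
theorem transpose_frameMatrix_mul_metricMatrix_mul {g : PseudoRiemannianMetric n M}
    (hG : ActsByIsometries G g) {x : Coord n} (hx : x ∈ e.target) :
    (frameMatrix e b x₀ x).transpose * metricMatrix g e x * frameMatrix e b x₀ x =
      gramMatrix g b x₀ := by
  have hxi : ∀ k, xi b x₀ k (e.symm x) =
      ∑ i, frameMatrix e b x₀ x i k • coordVector e x i := by
    intro k
    have h1 := ((contMDiffAt_chart_symm he hx).mdifferentiableAt (by simp)).hasMFDerivAt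
    have h2 := ((contMDiffAt_chart he (e.map_target hx)).mdifferentiableAt (by simp)).hasMFDerivAt
    have h1' : HasMFDerivAt (𝓡 n) (𝓡 n) e.symm (e (e.symm x))
      (show Coord n →L[ℝ] Coord n from mfderiv (𝓡 n) (𝓡 n) e.symm x) := by
      rw [e.right_inv hx]
      exact h1
    have h3 := (h1'.comp _ h2).mfderiv
    have h4 : (e.symm ∘ e) =ᶠ[𝓝 (e.symm x)] id := by
      filter_upwards [e.open_source.mem_nhds (e.map_target hx)] with y hy using e.left_inv hy
    rw [h4.mfderiv_eq, mfderiv_id] at h3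
    have h5 := congrArg (fun L => L (xi b x₀ k (e.symm x))) h3
    refine h5.trans ?_
    have h6 : frameVector e b x₀ k x =
        ∑ i, frameMatrix e b x₀ x i k • EuclideanSpace.single i (1 : ℝ) := by
      ext j
      simp [frameMatrix_apply, Pi.single_apply]
    change (show Coord n →L[ℝ] Coord n from mfderiv (𝓡 n) (𝓡 n) e.symm x)
      (frameVector e b x₀ k x) = _
    rw [h6, map_sum]
    refine Finset.sum_congr rfl fun i _ => ?_
    rw [map_smul]
    rfl
  ext k l
  rw [← val_xi_xi hst x₀ b hG (e.symm x) k l, hxi k, hxi l]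
  simp only [map_sum, map_smul, sum_apply, smul_apply,
    Matrix.mul_apply, Matrix.transpose_apply, metricMatrix, Matrix.of_apply, smul_eq_mul]
  exact Finset.sum_congr rfl fun j _ => mul_comm _ _

include hst he in
-- Invert Fᵀ g F = 𝐆, where F is the frame matrix. Only F has to be invertible, since
-- `Matrix.mul_inv_rev` holds without conditions.
theorem inv_metricMatrix {g : PseudoRiemannianMetric n M}
    (hG : ActsByIsometries G g) {x : Coord n} (hx : x ∈ e.target) :
    (metricMatrix g e x)⁻¹ =
      frameMatrix e b x₀ x * (gramMatrix g b x₀)⁻¹ * (frameMatrix e b x₀ x).transpose := by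
  have hu : IsUnit (frameMatrix e b x₀ x).det :=
    (frameMatrix_det_ne_zero hst he x₀ b hx).isUnit
  have hut : IsUnit (frameMatrix e b x₀ x).transpose.det := by rwa [Matrix.det_transpose]
  rw [← transpose_frameMatrix_mul_metricMatrix_mul hst he x₀ b hG hx, Matrix.mul_inv_rev,
    Matrix.mul_inv_rev, Matrix.mul_nonsing_inv_cancel_left _ _ hu, Matrix.mul_assoc,
    Matrix.nonsing_inv_mul _ hut, Matrix.mul_one]

end Frame

/-! ### The right action on H \ G in coordinates. -/

section Quotient

variable {n r : ℕ} {G : Type*} [Group G] {H : Subgroup G}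

theorem rho_proj (z w : G) : rho z (proj H w) = proj H (w * z) := rfl

theorem rho_mul (z w : G) (q : RightQuotient H) : rho (z * w) q = rho w (rho z q) := by
  induction q using Quotient.inductionOn with
  | _ w' =>
    change proj H (w' * (z * w)) = proj H (w' * z * w)
    rw [mul_assoc]

theorem rho_one (q : RightQuotient H) : rho (1 : G) q = q := by
  induction q using Quotient.inductionOn with
  | _ w' =>
    change proj H (w' * 1) = proj H w'
    rw [mul_one]

theorem proj_surjective (q : RightQuotient H) : ∃ z : G, proj H z = q :=
  Quotient.inductionOn q fun z => ⟨z, rfl⟩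

variable [TopologicalSpace G]

theorem continuous_rho [ContinuousMul G] (z : G) : Continuous (rho (H := H) z) :=
  Continuous.quotient_map' (continuous_mul_const z) _

variable [ChartedSpace (Coord n) G]

theorem continuous_proj : Continuous (proj H) := continuous_quotient_mk'

variable [LieGroup (𝓡 n) ∞ G] {c : OpenPartialHomeomorph (RightQuotient H) (Coord r)}

theorem IsSmoothChart.contMDiffAt (hc : IsSmoothChart (n := n) c) {z : G}
    (hz : proj H z ∈ c.source) : ContMDiffAt (𝓡 n) (𝓡 r) ∞ (fun z => c (proj H z)) z :=
  hc.contMDiffOn.contMDiffAt ((c.open_source.preimage continuous_proj).mem_nhds hz)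

/-- The projection `G → H \ G` has smooth local sections. -/
theorem IsSmoothChart.exists_section (hc : IsSmoothChart (n := n) c) {q₀ : Coord r}
    (hq₀ : q₀ ∈ c.target) : ∃ σ : Coord r → G, ContMDiffAt (𝓡 r) (𝓡 n) ∞ σ q₀ ∧
      ∀ᶠ q in 𝓝 q₀, proj H (σ q) = c.symm q := by
  have : IsManifold (𝓡 n) ∞ G := ContMDiffMul.toIsManifold
  obtain ⟨z, hz⟩ := proj_surjective (c.symm q₀)
  have hzs : proj H z ∈ c.source := hz ▸ c.map_target hq₀
  have hF := hc.contMDiffAt hzs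
  set F : G → Coord r := fun z => c (proj H z) with hFdef
  have hFz : F z = q₀ := by simp [hFdef, hz, c.right_inv hq₀]
  set a := extChartAt (𝓡 n) z with ha
  have haz : a.symm (a z) = z := by simp [ha]
  have hasm : ContMDiffAt 𝓘(ℝ, Coord n) (𝓡 n) ∞ a.symm (a z) :=
    (contMDiffOn_extChartAt_symm (I := 𝓡 n) z).contMDiffAt (extChartAt_target_mem_nhds z)
  have hFa : ContDiffAt ℝ ∞ (F ∘ a.symm) (a z) :=
    (ContMDiffAt.comp (a z) (haz.symm ▸ hF) hasm).contDiffAt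
  have hder : HasFDerivAt (F ∘ a.symm)
      (show Coord n →L[ℝ] Coord r from mfderiv (𝓡 n) (𝓡 r) F z) (a z) := by
    have h1 := (hF.mdifferentiableAt (by simp)).hasMFDerivAt.2
    rw [ModelWithCorners.range_eq_univ] at h1
    exact hasFDerivWithinAt_univ.mp h1
  set D : Coord n →L[ℝ] Coord r := mfderiv (𝓡 n) (𝓡 r) F z with hD
  -- A linear right inverse of the differential selects an affine slice transverse to the fibre.
  -- Restricted to it, the projection has the identity as derivative, and its local inverse is the
  -- section.
  obtain ⟨R, hR⟩ := (D : Coord n →ₗ[ℝ] Coord r).exists_rightInverse_of_surjective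
    (LinearMap.range_eq_top.mpr (hc.submersion z hzs))
  set R' : Coord r →L[ℝ] Coord n := LinearMap.toContinuousLinearMap R with hR'
  have hDR : ∀ v, D (R' v) = v := fun v => congrArg (fun T => T v) hR
  have haff : ContDiff ℝ ∞ fun v => a z + R' v := contDiff_const.add R'.contDiff
  have haff0 : a z + R' 0 = a z := by simp
  set K : Coord r → Coord r := fun v => (F ∘ a.symm) (a z + R' v) with hK
  have hKs : ContDiffAt ℝ ∞ K 0 :=
    ContDiffAt.comp (g := F ∘ a.symm) (0 : Coord r) (by rw [haff0]; exact hFa) haff.contDiffAt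
  have hKd : HasFDerivAt K ((ContinuousLinearEquiv.refl ℝ (Coord r)) : Coord r →L[ℝ] Coord r) 0 := by
    have h1 : HasFDerivAt (fun v => a z + R' v) R' 0 := R'.hasFDerivAt.const_add _
    have h2 := HasFDerivAt.comp (g := F ∘ a.symm) (0 : Coord r) (by rw [haff0]; exact hder) h1
    have h3 : D.comp R' = ((ContinuousLinearEquiv.refl ℝ (Coord r)) : Coord r →L[ℝ] Coord r) :=
      ContinuousLinearMap.ext hDR
    rw [← h3]
    exact h2
  have hK0 : K 0 = q₀ := by simp [hK, haz, hFz]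
  have hk := hKs.to_localInverse hKd (by simp)
  have hkpt := hKs.localInverse_apply_image hKd (by simp)
  have hright := (hKs.hasStrictFDerivAt' hKd (by simp)).eventually_right_inverse
  change ∀ᶠ y in 𝓝 (K 0), K (hKs.localInverse hKd (by simp) y) = y at hright
  set k := hKs.localInverse hKd (by simp)
  rw [hK0] at hk hkpt hright
  have hk' : ContMDiffAt (𝓡 r) (𝓡 n) ∞ (fun q => a z + R' (k q)) q₀ :=
    (contDiffAt_const.add (R'.contDiff.contDiffAt.comp q₀ hk)).contMDiffAt
  have hσ : ContMDiffAt (𝓡 r) (𝓡 n) ∞ (a.symm ∘ fun q => a z + R' (k q)) q₀ :=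
    ContMDiffAt.comp q₀ (by rw [hkpt, haff0]; exact hasm) hk'
  have hσ0 : (a.symm ∘ fun q => a z + R' (k q)) q₀ = z := by simp [hkpt, haz]
  refine ⟨_, hσ, ?_⟩
  have hsrc : ∀ᶠ q in 𝓝 q₀, proj H ((a.symm ∘ fun q => a z + R' (k q)) q) ∈ c.source := by
    refine (continuous_proj.continuousAt.comp hσ.continuousAt).eventually_mem ?_
    refine c.open_source.mem_nhds ?_
    change proj H ((a.symm ∘ fun q => a z + R' (k q)) q₀) ∈ c.source
    rw [hσ0]
    exact hzs
  filter_upwards [hright, hsrc] with q h1 h2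
  have h3 : c (proj H ((a.symm ∘ fun q => a z + R' (k q)) q)) = q := h1
  conv_rhs => rw [← h3]
  exact (c.left_inv h2).symm

/-- The right action of `G` on `H \ G`, in the chart `c`. -/
def actionCoord (c : OpenPartialHomeomorph (RightQuotient H) (Coord r)) (z : G) (q : Coord r) :
    Coord r := c (rho z (c.symm q))

/-- With a smooth local section σ, the action is the projection of the product σ(q)·z, which is
smooth on G. -/
theorem contMDiffAt_actionCoord (hc : IsSmoothChart (n := n) c) {z : G} {q : Coord r}
    (hq : q ∈ c.target) (hz : rho z (c.symm q) ∈ c.source) :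
    ContMDiffAt ((𝓡 n).prod (𝓡 r)) (𝓡 r) ∞ (fun t : G × Coord r => actionCoord c t.1 t.2)
      (z, q) := by
  obtain ⟨σ, hσ, hσq⟩ := hc.exists_section hq
  have h1 : ContMDiffAt ((𝓡 n).prod (𝓡 r)) (𝓡 n) ∞ (fun t : G × Coord r => σ t.2 * t.1) (z, q) :=
    ContMDiffAt.mul (ContMDiffAt.comp (z, q) (g := σ) hσ contMDiffAt_snd) contMDiffAt_fst
  have hpt : proj H (σ q * z) = rho z (c.symm q) := by
    rw [← rho_proj, hσq.self_of_nhds]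
  have h2 := ContMDiffAt.comp (z, q) (hc.contMDiffAt (z := σ q * z) (by rwa [hpt])) h1
  refine h2.congr_of_eventuallyEq ?_
  filter_upwards [continuous_snd.continuousAt.eventually hσq] with t ht
  simp only [actionCoord, Function.comp_apply]
  rw [← rho_proj, ht]

theorem actionCoord_mul {z : G} {q : Coord r} (hz : rho z (c.symm q) ∈ c.source) (w : G) :
    actionCoord c (z * w) q = actionCoord c w (actionCoord c z q) := by
  simp only [actionCoord, rho_mul, c.left_inv hz]

/-- Differentiate ρ_{zw} q = ρ_w(ρ_z q) at w = 1. Because the action is on the right, left-invariant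
fields go to the generators at the moved point. -/
theorem mfderiv_actionCoord_mulInvariantVectorField (hc : IsSmoothChart (n := n) c)
    (b : Module.Basis (Fin n) ℝ (GroupLieAlgebra (𝓡 n) G)) {z : G} {q : Coord r}
    (hq : q ∈ c.target) (hz : rho z (c.symm q) ∈ c.source) (k : Fin n) :
    mfderiv (𝓡 n) (𝓡 r) (fun w => actionCoord c w q) z (mulInvariantVectorField (I := 𝓡 n) (b k) z)
      = zeta c b k (actionCoord c z q) := by
  have h1 : ContMDiffAt (𝓡 n) (𝓡 r) ∞ (fun w => actionCoord c w q) z :=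
    ContMDiffAt.comp (g := fun t : G × Coord r => actionCoord c t.1 t.2) z (contMDiffAt_actionCoord hc hq hz) (contMDiffAt_id.prodMk contMDiffAt_const)
  have h2 : HasMFDerivAt (𝓡 n) (𝓡 r) (fun w => actionCoord c w q) (z * 1)
      (show Coord n →L[ℝ] Coord r from mfderiv (𝓡 n) (𝓡 r) (fun w => actionCoord c w q) z) := by
    rw [mul_one]
    exact (h1.mdifferentiableAt (by simp)).hasMFDerivAt
  have h3 := (h2.comp 1 ((contMDiff_mul_left (I := 𝓡 n) (n := ∞) (a := z)).mdifferentiable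
    (by simp) 1).hasMFDerivAt).mfderiv
  have h4 : (fun w => actionCoord c w q) ∘ (fun w => z * w) =
      fun w => c (rho w (c.symm (actionCoord c z q))) :=
    funext fun w => actionCoord_mul hz w
  rw [h4] at h3
  exact (congrArg (fun L => L (b k)) h3).symm

theorem actionCoord_mem_target {z : G} {q : Coord r} (hz : rho z (c.symm q) ∈ c.source) :
    actionCoord c z q ∈ c.target := c.map_source hz

/-- ρ_{z⁻¹} is a smooth inverse of ρ_z. This gives the q-block of the nondegeneracy. -/
theorem fderiv_actionCoord_injective (hc : IsSmoothChart (n := n) c) {z : G} {q : Coord r}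
    (hq : q ∈ c.target) (hz : rho z (c.symm q) ∈ c.source) :
    Function.Injective (fderiv ℝ (fun q => actionCoord c z q) q) := by
  have hd : ∀ {z : G} {q : Coord r}, q ∈ c.target → rho z (c.symm q) ∈ c.source →
      MDifferentiableAt (𝓡 r) (𝓡 r) (fun q => actionCoord c z q) q := fun {z q} hq hz =>
    (ContMDiffAt.comp q (contMDiffAt_actionCoord hc hq hz)
      (contMDiffAt_const.prodMk contMDiffAt_id)).mdifferentiableAt (by simp)
  have hinv : ∀ q, rho z (c.symm q) ∈ c.source →
      rho z⁻¹ (c.symm (actionCoord c z q)) = c.symm q := by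
    intro q hz
    rw [actionCoord, c.left_inv hz, ← rho_mul, mul_inv_cancel, rho_one]
  have h := mfderiv_injective_of_leftInverse (h := fun q => actionCoord c z⁻¹ q) (hd hq hz)
    (hd (actionCoord_mem_target hz) (by rw [hinv q hz]; exact c.map_target hq)) ?_
  · rw [mfderiv_eq_fderiv] at h
    exact h
  · have := continuousMul_of_contMDiffMul (𝓡 n) ∞ (G := G)
    have hcont : ContinuousAt (fun q => rho z (c.symm q)) q :=
      (continuous_rho z).continuousAt.comp (c.continuousAt_symm hq)
    filter_upwards [c.open_target.mem_nhds hq, hcont.eventually_mem (c.open_source.mem_nhds hz)]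
      with q' h1 h2
    rw [actionCoord, hinv q' h2, c.right_inv h1]

variable {M : Type*} [TopologicalSpace M] [ChartedSpace (Coord n) M] [IsManifold (𝓡 n) ∞ M]
  [MulAction G M] [ContMDiffSMul (𝓡 n) (𝓡 n) ∞ G M] {e : OpenPartialHomeomorph M (Coord n)}
  (hst : SimplyTransitive G M) (he : e ∈ IsManifold.maximalAtlas (𝓡 n) ∞ M) (x₀ : M)
  (b : Module.Basis (Fin n) ℝ (GroupLieAlgebra (𝓡 n) G)) (hc : IsSmoothChart (n := n) c)

include hst he hc in
theorem contDiffAt_phiCoord {x : Coord n} {q : Coord r} (hx : x ∈ e.target) (hq : q ∈ c.target)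
    (hφ : phi x₀ (e.symm x) (c.symm q) ∈ c.source) :
    ContDiffAt ℝ ∞ (fun t : Coord n × Coord r => phiCoord e c x₀ t.1 t.2) (x, q) := by
  have h1 : ContMDiffAt 𝓘(ℝ, Coord n × Coord r) (𝓡 n) ∞
      (fun t : Coord n × Coord r => groupPoint G e x₀ t.1) (x, q) :=
    ContMDiffAt.comp (I' := 𝓡 n) (g := groupPoint G e x₀) (f := Prod.fst) (x, q)
      (contMDiffAt_groupPoint hst he x₀ hx) contDiff_fst.contMDiff.contMDiffAt
  have h2 : ContMDiffAt 𝓘(ℝ, Coord n × Coord r) (𝓡 r) ∞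
      (fun t : Coord n × Coord r => t.2) (x, q) := contDiff_snd.contMDiff.contMDiffAt
  exact (ContMDiffAt.comp (x, q) (contMDiffAt_actionCoord hc hq hφ) (h1.prodMk h2)).contDiffAt

include hst he hc in
-- φ(·,q) is ψ⁻¹ followed by z ↦ ρ_z q: the first map takes ξ_k to the left-invariant field of e_k,
-- the second takes that to ζ_k.
theorem fderiv_phiCoord_frameVector {x : Coord n} {q : Coord r} (hx : x ∈ e.target)
    (hq : q ∈ c.target) (hφ : phi x₀ (e.symm x) (c.symm q) ∈ c.source) (k : Fin n) :
    fderiv ℝ (fun x => phiCoord e c x₀ x q) x (frameVector e b x₀ k x) =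
      zeta c b k (phiCoord e c x₀ x q) := by
  have h1 : ContMDiffAt (𝓡 n) (𝓡 r) ∞ (fun w => actionCoord c w q) (groupPoint G e x₀ x) :=
    ContMDiffAt.comp (g := fun t : G × Coord r => actionCoord c t.1 t.2) (groupPoint G e x₀ x)
      (contMDiffAt_actionCoord hc hq hφ) (contMDiffAt_id.prodMk contMDiffAt_const)
  have h2 := mfderiv_comp x (h1.mdifferentiableAt (by simp))
    ((contMDiffAt_groupPoint hst he x₀ hx).mdifferentiableAt (by simp))
  have h3 := congrArg (fun L => L (frameVector e b x₀ k x)) h2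
  have h4 := mfderiv_actionCoord_mulInvariantVectorField hc b hq hφ k
  rw [mfderiv_eq_fderiv] at h3
  refine h3.trans (Eq.trans ?_ h4)
  exact congrArg _ (mfderiv_groupPoint_frameVector hst he x₀ b hx k)

end Quotient

/-! ### Integrals with parameters and the Poincaré lemma. -/

section ParametricIntegral

universe u

/-- Compactness of a closed ball times [0, 1] supplies the constant majorant for differentiation
under the integral sign. -/
theorem exists_bound_near_of_continuousAt {E F : Type*} [NormedAddCommGroup E] [NormedSpace ℝ E]
    [ProperSpace E] [NormedAddCommGroup F] [NormedSpace ℝ F] {s : Set E} (hs : IsOpen s)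
    {f : E → ℝ → F}
    (hf : ∀ p ∈ s, ∀ t ∈ Icc (0 : ℝ) 1, ContinuousAt (Function.uncurry f) (p, t)) {p : E}
    (hp : p ∈ s) : ∃ C : ℝ, ∃ ε > 0, Metric.ball p ε ⊆ s ∧
      ∀ p' ∈ Metric.ball p ε, ∀ t ∈ Icc (0 : ℝ) 1, ‖f p' t‖ ≤ C := by
  obtain ⟨ε, hε, hsub⟩ := Metric.nhds_basis_closedBall.mem_iff.mp (hs.mem_nhds hp)
  obtain ⟨C, hC⟩ := ((isCompact_closedBall p ε).prod (isCompact_Icc (a := (0 : ℝ)) (b := 1)))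
    |>.exists_bound_of_continuousOn (f := Function.uncurry f)
      fun t ht => (hf t.1 (hsub ht.1) t.2 ht.2).continuousWithinAt
  exact ⟨C, ε, hε, Metric.ball_subset_closedBall.trans hsub,
    fun p' hp' t ht => hC (p', t) ⟨Metric.ball_subset_closedBall hp', ht⟩⟩

theorem continuousOn_slice {E F : Type*} [TopologicalSpace E] [TopologicalSpace F] 
    {s : Set E} {f : E → ℝ → F}
    (hf : ∀ p ∈ s, ∀ t ∈ Icc (0 : ℝ) 1, ContinuousAt (Function.uncurry f) (p, t)) {p : E}
    (hp : p ∈ s) : ContinuousOn (f p) (uIcc (0 : ℝ) 1) := by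
  rw [uIcc_of_le zero_le_one]
  intro t ht
  exact (ContinuousAt.comp (g := Function.uncurry f) (f := fun t => (p, t)) (hf p hp t ht)
    (by fun_prop)).continuousWithinAt

/-- An integral over `[0, 1]` that depends on a parameter is as smooth as the integrand. -/
theorem contDiffOn_intervalIntegral_nat {E : Type u} [NormedAddCommGroup E] [NormedSpace ℝ E]
    [ProperSpace E] {s : Set E} (hs : IsOpen s) (m : ℕ) :
    ∀ {F : Type u} [NormedAddCommGroup F] [NormedSpace ℝ F] {f : E → ℝ → F},
      (∀ p ∈ s, ∀ t ∈ Icc (0 : ℝ) 1, ContDiffAt ℝ m (Function.uncurry f) (p, t)) →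
      ContDiffOn ℝ m (fun p => ∫ t in (0 : ℝ)..1, f p t) s := by
  have hmem : ∀ {t : ℝ}, t ∈ uIoc (0 : ℝ) 1 → t ∈ Icc (0 : ℝ) 1 := fun ht => by
    rw [uIoc_of_le zero_le_one] at ht
    exact ⟨ht.1.le, ht.2⟩
  induction m with
  | zero =>
    intro F _ _ f hf
    have hc : ∀ p ∈ s, ∀ t ∈ Icc (0 : ℝ) 1, ContinuousAt (Function.uncurry f) (p, t) :=
      fun p hp t ht => (hf p hp t ht).continuousAt
    simp only [Nat.cast_zero, contDiffOn_zero]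
    intro p hp
    obtain ⟨C, ε, hε, hsub, hC⟩ := exists_bound_near_of_continuousAt hs hc hp
    refine (intervalIntegral.continuousAt_of_dominated_interval (bound := fun _ => C) ?_ ?_
      intervalIntegrable_const ?_).continuousWithinAt
    · filter_upwards [hs.mem_nhds hp] with p' hp'
      exact (continuousOn_slice hc hp').intervalIntegrable.aestronglyMeasurable_restrict_uIoc
    · filter_upwards [Metric.ball_mem_nhds p hε] with p' hp'
      exact .of_forall fun t ht => hC p' hp' t (hmem ht)
    · refine .of_forall fun t ht => ?_
      exact ContinuousAt.comp (g := Function.uncurry f) (f := fun p => (p, t))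
        (hc p hp t (hmem ht)) (by fun_prop)
  | succ m ih =>
    intro F _ _ f hf
    have hc : ∀ p ∈ s, ∀ t ∈ Icc (0 : ℝ) 1, ContinuousAt (Function.uncurry f) (p, t) :=
      fun p hp t ht => (hf p hp t ht).continuousAt
    -- The derivative in the parameter has values in `E →L[ℝ] F`, so the induction runs over all
    -- targets F, in the same universe as E.
    set f' : E → ℝ → E →L[ℝ] F := fun p t =>
      (fderiv ℝ (Function.uncurry f) (p, t)).comp (ContinuousLinearMap.inl ℝ E ℝ) with hf'
    have hf's : ∀ p ∈ s, ∀ t ∈ Icc (0 : ℝ) 1, ContDiffAt ℝ m (Function.uncurry f') (p, t) := by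
      intro p hp t ht
      exact ((hf p hp t ht).fderiv_right (m := m) (by norm_cast)).clm_comp contDiffAt_const
    have hc' : ∀ p ∈ s, ∀ t ∈ Icc (0 : ℝ) 1, ContinuousAt (Function.uncurry f') (p, t) :=
      fun p hp t ht => (hf's p hp t ht).continuousAt
    have hder : ∀ p ∈ s, HasFDerivAt (fun p => ∫ t in (0 : ℝ)..1, f p t)
        (∫ t in (0 : ℝ)..1, f' p t) p := by
      intro p hp
      obtain ⟨C, ε, hε, hsub, hC⟩ := exists_bound_near_of_continuousAt hs hc' hp
      refine intervalIntegral.hasFDerivAt_integral_of_dominated_of_fderiv_le (bound := fun _ => C)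
        (F' := f') (Metric.ball_mem_nhds p hε) ?_ (continuousOn_slice hc hp).intervalIntegrable
        (continuousOn_slice hc' hp).intervalIntegrable.aestronglyMeasurable_restrict_uIoc ?_
        intervalIntegrable_const ?_
      · filter_upwards [hs.mem_nhds hp] with p' hp'
        exact (continuousOn_slice hc hp').intervalIntegrable.aestronglyMeasurable_restrict_uIoc
      · exact .of_forall fun t ht p' hp' => hC p' hp' t (hmem ht)
      · refine .of_forall fun t ht p' hp' => ?_
        have h1 := ((hf p' (hsub hp') t (hmem ht)).differentiableAt (by simp)).hasFDerivAt
        exact HasFDerivAt.comp (g := Function.uncurry f) (f := fun e => (e, t)) p' h1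
          (hasFDerivAt_prodMk_left p' t)
    have hm : ((m + 1 : ℕ) : WithTop ℕ∞) = (m : WithTop ℕ∞) + 1 := by norm_cast
    rw [hm, contDiffOn_succ_iff_fderiv_of_isOpen hs]
    refine ⟨fun p hp => (hder p hp).differentiableAt.differentiableWithinAt, by simp, ?_⟩
    exact (ih hf's).congr fun p hp => (hder p hp).fderiv

theorem contDiffOn_intervalIntegral {E F : Type u} [NormedAddCommGroup E] [NormedSpace ℝ E]
    [ProperSpace E] [NormedAddCommGroup F] [NormedSpace ℝ F] {s : Set E} (hs : IsOpen s)
    {f : E → ℝ → F}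
    (hf : ∀ p ∈ s, ∀ t ∈ Icc (0 : ℝ) 1, ContDiffAt ℝ ∞ (Function.uncurry f) (p, t)) :
    ContDiffOn ℝ ∞ (fun p => ∫ t in (0 : ℝ)..1, f p t) s :=
  contDiffOn_infty.mpr fun m => contDiffOn_intervalIntegral_nat hs m fun p hp t ht =>
    (hf p hp t ht).of_le (by exact_mod_cast le_top)

/-- The Poincaré lemma for a family of closed 1-forms on a convex open set, with smooth dependence
on the parameters. -/
theorem exists_contDiffOn_primitive {E P : Type} [NormedAddCommGroup E] [NormedSpace ℝ E]
    [ProperSpace E] [NormedAddCommGroup P] [NormedSpace ℝ P] [ProperSpace P] {B : Set E} {Q : Set P}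
    (hB : IsOpen B) (hconv : Convex ℝ B) (hQ : IsOpen Q) {θ : E → P → E →L[ℝ] ℝ}
    (hθ : ContDiffOn ℝ ∞ (Function.uncurry θ) (B ×ˢ Q))
    (hsymm : ∀ x ∈ B, ∀ y ∈ Q, ∀ v w, fderiv ℝ (fun x => θ x y) x v w =
      fderiv ℝ (fun x => θ x y) x w v) :
    ∃ W : E → P → ℝ, ContDiffOn ℝ ∞ (Function.uncurry W) (B ×ˢ Q) ∧
      ∀ x ∈ B, ∀ y ∈ Q, HasFDerivAt (fun x => W x y) (θ x y) x := by
  rcases B.eq_empty_or_nonempty with rfl | ⟨a, ha⟩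
  · exact ⟨0, by simp, by simp⟩
  have hθat : ∀ x ∈ B, ∀ y ∈ Q, ContDiffAt ℝ ∞ (Function.uncurry θ) (x, y) := fun x hx y hy =>
    hθ.contDiffAt ((hB.prod hQ).mem_nhds ⟨hx, hy⟩)
  have hθd : ∀ x ∈ B, ∀ y ∈ Q, DifferentiableAt ℝ (fun x => θ x y) x := fun x hx y hy =>
    ((hθat x hx y hy).differentiableAt (by simp)).comp (f := fun x => (x, y)) x (by fun_prop)
  -- The primitive is the integral of the form along the segment from the fixed point a to x.
  refine ⟨fun x y => ∫ᶜ x' in .segment a x, θ x' y, ?_, ?_⟩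
  · have h1 : ∀ z : E × P, Function.uncurry (fun x y => ∫ᶜ x' in .segment a x, θ x' y) z =
        ∫ t in (0 : ℝ)..1, θ (AffineMap.lineMap a z.1 t) z.2 (z.1 - a) := fun z =>
      curveIntegral_segment _ _ _
    refine ContDiffOn.congr ?_ fun z _ => h1 z
    refine contDiffOn_intervalIntegral
      (f := fun (z : E × P) t => θ (AffineMap.lineMap a z.1 t) z.2 (z.1 - a)) (hB.prod hQ) ?_
    rintro ⟨x, y⟩ ⟨hx, hy⟩ t ht
    have hline : AffineMap.lineMap a x t ∈ B := hconv.lineMap_mem ha hx ht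
    have h2 : ContDiff ℝ ∞ fun z : (E × P) × ℝ => (AffineMap.lineMap a z.1.1 z.2, z.1.2) := by
      simp only [AffineMap.lineMap_apply, vsub_eq_sub, vadd_eq_add]
      fun_prop
    have h3 : ContDiffAt ℝ ∞ (fun z : (E × P) × ℝ => θ (AffineMap.lineMap a z.1.1 z.2) z.1.2)
        ((x, y), t) :=
      ContDiffAt.comp (g := Function.uncurry θ) ((x, y), t) (hθat _ hline y hy) h2.contDiffAt
    have h4 : ContDiff ℝ ∞ fun z : (E × P) × ℝ => z.1.1 - a := by fun_prop
    exact h3.clm_apply h4.contDiffAt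
  · intro x hx y hy
    exact (hconv.hasFDerivWithinAt_curveIntegral_segment_of_hasFDerivWithinAt_symmetric
      (fun x hx => (hθd x hx y hy).hasFDerivAt.hasFDerivWithinAt)
      (fun x hx v _ w _ => hsymm x hx y hy v w) ha hx).hasFDerivAt (hB.mem_nhds hx)

end ParametricIntegral

/-! ### Closedness of a 1-form, tested on a frame -/

/-- Cartan's formula: dθ(ξ_i, ξ_j) = ξ_i θ(ξ_j) - ξ_j θ(ξ_i) - θ([ξ_i, ξ_j]). If this vanishes for
all pairs from a spanning family, bilinearity gives dθ = 0. -/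
theorem fderiv_symm_of_frame {E : Type*} [NormedAddCommGroup E] [NormedSpace ℝ E] {ι : Type*}
    [Fintype ι] {x : E} {θ : E → E →L[ℝ] ℝ} {ξ : ι → E → E} {a : ι → E → ℝ}
    (hθ : DifferentiableAt ℝ θ x) (hξ : ∀ k, DifferentiableAt ℝ (ξ k) x)
    (ha : ∀ k, ∀ᶠ y in 𝓝 x, a k y = θ y (ξ k y))
    (hspan : ∀ v : E, ∃ d : ι → ℝ, v = ∑ k, d k • ξ k x)
    (hclosed : ∀ i j, fderiv ℝ (a j) x (ξ i x) - fderiv ℝ (a i) x (ξ j x) =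
      θ x (fderiv ℝ (ξ j) x (ξ i x) - fderiv ℝ (ξ i) x (ξ j x))) (v w : E) :
    fderiv ℝ θ x v w = fderiv ℝ θ x w v := by
  have hder : ∀ k u, fderiv ℝ (a k) x u = fderiv ℝ θ x u (ξ k x) + θ x (fderiv ℝ (ξ k) x u) := by
    intro k u
    rw [Filter.EventuallyEq.fderiv_eq (ha k), fderiv_clm_apply hθ (hξ k)]
    simp [add_comm]
  have hframe : ∀ i j, fderiv ℝ θ x (ξ i x) (ξ j x) = fderiv ℝ θ x (ξ j x) (ξ i x) := by
    intro i j
    have h := hclosed i j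
    rw [hder, hder, map_sub] at h
    linarith
  obtain ⟨d, rfl⟩ := hspan v
  obtain ⟨d', rfl⟩ := hspan w
  simp only [map_sum, map_smul, sum_apply, smul_apply, smul_eq_mul, Finset.mul_sum]
  rw [Finset.sum_comm]
  refine Finset.sum_congr rfl fun i _ => Finset.sum_congr rfl fun j _ => ?_
  rw [hframe j i]
  ring

/-! ### The 1-forms a_l ω^l. -/

section Form

variable {n : ℕ} {G : Type*} [TopologicalSpace G] [ChartedSpace (Coord n) G]
  {M : Type*} [TopologicalSpace M] [ChartedSpace (Coord n) M]
  [Group G] [LieGroup (𝓡 n) ∞ G] [IsManifold (𝓡 n) ∞ M]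
  [MulAction G M] [ContMDiffSMul (𝓡 n) (𝓡 n) ∞ G M] {e : OpenPartialHomeomorph M (Coord n)}
  (hst : SimplyTransitive G M) (he : e ∈ IsManifold.maximalAtlas (𝓡 n) ∞ M) (x₀ : M)
  (b : Module.Basis (Fin n) ℝ (GroupLieAlgebra (𝓡 n) G))

include hst he in
theorem sum_coframeMatrix_mul_frameVector {x : Coord n} (hx : x ∈ e.target) (l k : Fin n) :
    ∑ i, coframeMatrix e b x₀ x l i * frameVector e b x₀ k x i = if l = k then 1 else 0 := by
  have h := congrFun (congrFun (coframeMatrix_mul_frameMatrix hst he x₀ b hx) l) k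
  rwa [Matrix.mul_apply, Matrix.one_apply] at h

include hst he in
theorem eq_sum_smul_frameVector {x : Coord n} (hx : x ∈ e.target) (v : Coord n) :
    v = ∑ k, (∑ i, coframeMatrix e b x₀ x k i * v i) • frameVector e b x₀ k x := by
  have h := congrArg (fun A : Matrix (Fin n) (Fin n) ℝ => A.mulVec v)
    (frameMatrix_mul_coframeMatrix hst he x₀ b hx)
  simp only [← Matrix.mulVec_mulVec, Matrix.one_mulVec] at h
  ext i
  have hi := congrFun h i
  simp only [Matrix.mulVec, dotProduct, frameMatrix_apply] at hi
  rw [← hi]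
  simp [mul_comm]

/-- The 1-form `a_l ω^l` in the chart `e`. -/
def coframeForm (e : OpenPartialHomeomorph M (Coord n))
    (b : Module.Basis (Fin n) ℝ (GroupLieAlgebra (𝓡 n) G)) (x₀ : M) (a : Fin n → ℝ) (x : Coord n) :
    Coord n →L[ℝ] ℝ :=
  ∑ i, (∑ l, a l * coframeMatrix e b x₀ x l i) • EuclideanSpace.proj (𝕜 := ℝ) i

theorem coframeForm_apply (a : Fin n → ℝ) (x v : Coord n) :
    coframeForm e b x₀ a x v = ∑ i, (∑ l, a l * coframeMatrix e b x₀ x l i) * v i := by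
  simp [coframeForm]

include hst he in
theorem coframeForm_frameVector {x : Coord n} (hx : x ∈ e.target) (a : Fin n → ℝ) (k : Fin n) :
    coframeForm e b x₀ a x (frameVector e b x₀ k x) = a k := by
  rw [coframeForm_apply]
  simp only [Finset.sum_mul]
  rw [Finset.sum_comm]
  have h : ∀ l, ∑ i, a l * coframeMatrix e b x₀ x l i * frameVector e b x₀ k x i =
      a l * if l = k then 1 else 0 := fun l => by
    rw [← sum_coframeMatrix_mul_frameVector hst he x₀ b hx, Finset.mul_sum]
    exact Finset.sum_congr rfl fun i _ => by ring
  simp [h]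

include hst he in
theorem contDiffOn_coframeForm {P : Type*} [NormedAddCommGroup P] [NormedSpace ℝ P]
    {D : Set (Coord n × P)} {a : Fin n → Coord n × P → ℝ} (hD : ∀ t ∈ D, t.1 ∈ e.target)
    (ha : ∀ l, ContDiffOn ℝ ∞ (a l) D) :
    ContDiffOn ℝ ∞ (fun t => coframeForm e b x₀ (fun l => a l t) t.1) D := by
  unfold coframeForm
  refine ContDiffOn.sum fun i _ => ContDiffOn.smul (ContDiffOn.sum fun l _ => (ha l).mul ?_)
    contDiffOn_const
  exact (contDiffOn_coframeMatrix hst he x₀ b l i).comp contDiffOn_fst hD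

end Form

/-! ### The functions f_i and their bracket relations. -/

section Transition

variable {n k r : ℕ} {G : Type*} [TopologicalSpace G] [ChartedSpace (Coord n) G]
  [Group G] [LieGroup (𝓡 n) ∞ G] {H : Subgroup G}
  {c : OpenPartialHomeomorph (RightQuotient H) (Coord r)}
  {b : Module.Basis (Fin n) ℝ (GroupLieAlgebra (𝓡 n) G)}
  {χ : Fin n → Coord r → DualLie n G → ℝ} {μ : DualLie n G} {T : Set (Coord r × Coord r)}

theorem partialDeriv_transition (i : Fin n) (q p : Coord r) (a : Fin r) :
    partialDeriv (fun p' => transition c b χ μ i q p') a p = zeta c b i q a := by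
  have h : HasFDerivAt (fun p' : Coord r => transition c b χ μ i q p')
      (∑ a, zeta c b i q a • EuclideanSpace.proj (𝕜 := ℝ) a) p := by
    unfold transition
    refine HasFDerivAt.add_const _ (HasFDerivAt.fun_sum fun a _ => ?_)
    exact (EuclideanSpace.proj (𝕜 := ℝ) a).hasFDerivAt.const_mul _
  rw [partialDeriv, h.fderiv]
  simp

theorem transition_zero (i : Fin n) (q : Coord r) : transition c b χ μ i q 0 = χ i q μ := by
  simp [transition]

theorem fderiv_apply_eq_sum_partialDeriv {d : ℕ} (u : Coord d → ℝ) (x v : Coord d) :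
    fderiv ℝ u x v = ∑ i, v i * partialDeriv u i x := by
  have hv : v = ∑ i, v i • EuclideanSpace.single i (1 : ℝ) := by
    ext j
    simp [Pi.single_apply]
  conv_lhs => rw [hv]
  simp [partialDeriv]

/-- The bracket relations at `p = 0`. -/
theorem IsCanonicalTransition.fderiv_sub_fderiv
    (hf : IsCanonicalTransition b μ c.target T (transition c b χ μ)) {q : Coord r}
    (hq : q ∈ c.target) (i j : Fin n) :
    fderiv ℝ (fun q => χ j q μ) q (zeta c b i q) - fderiv ℝ (fun q => χ i q μ) q (zeta c b j q) =
      ∑ l, b.repr ⁅b i, b j⁆ l * χ l q μ := by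
  have h := hf.bracket q hq 0 i j
  -- At p = 0 the functions f_i reduce to χ_i, while their p-derivatives remain ζ_i.
  simp only [partialDeriv_transition, transition_zero] at h
  rw [← h, fderiv_apply_eq_sum_partialDeriv, fderiv_apply_eq_sum_partialDeriv,
    ← Finset.sum_sub_distrib]
  exact Finset.sum_congr rfl fun a _ => by ring

/-- f is affine in p, so ζ_i^a is the difference of its values at the a-th basis vector and at 0. -/
theorem IsCanonicalTransition.contDiffOn_zeta
    (hf : IsCanonicalTransition b μ c.target T (transition c b χ μ)) (i : Fin n) (a : Fin r) :
    ContDiffOn ℝ ∞ (fun q => zeta c b i q a) c.target := by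
  have h : ∀ p : Coord r, ContDiffOn ℝ ∞ (fun q => transition c b χ μ i q p) c.target := fun p =>
    (hf.contDiffOn i).comp (f := fun q => (q, p)) (by fun_prop) fun q hq => ⟨hq, mem_univ _⟩
  refine ((h (EuclideanSpace.single a 1)).sub (h 0)).congr fun q _ => ?_
  simp [transition]

end Transition

/-! ### Existence of the integral. -/

section Primitive

variable {n k r : ℕ} {G : Type*} [TopologicalSpace G] [ChartedSpace (Coord n) G]
  {M : Type*} [TopologicalSpace M] [ChartedSpace (Coord n) M]
  [Group G] [LieGroup (𝓡 n) ∞ G] [IsManifold (𝓡 n) ∞ M]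
  [MulAction G M] [ContMDiffSMul (𝓡 n) (𝓡 n) ∞ G M] {e : OpenPartialHomeomorph M (Coord n)}
  (hst : SimplyTransitive G M) (he : e ∈ IsManifold.maximalAtlas (𝓡 n) ∞ M) (x₀ : M)
  (b : Module.Basis (Fin n) ℝ (GroupLieAlgebra (𝓡 n) G)) {H : Subgroup G}
  {c : OpenPartialHomeomorph (RightQuotient H) (Coord r)} (hc : IsSmoothChart (n := n) c)
  {χ : Fin n → Coord r → DualLie n G → ℝ} {J : Set (Coord k)} {lam : Coord k → DualLie n G}

include hst he hc in
theorem exists_isPrimitive (hJ : IsOpen J)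
    (hχ : ∀ i, ContDiffOn ℝ ∞ (fun t : Coord r × Coord k => χ i t.1 (lam t.2)) (c.target ×ˢ J))
    {T : Coord k → Set (Coord r × Coord r)}
    (hf : ∀ j ∈ J, IsCanonicalTransition b (lam j) c.target (T j) (transition c b χ (lam j)))
    {B : Set (Coord n)} {P : Set (Coord r × Coord k)} (hB : IsOpen B) (hconv : Convex ℝ B)
    (hP : IsOpen P) (hBP : B ×ˢ P ⊆ formDomain e c x₀ J) :
    ∃ W, IsPrimitive ∞ e c b x₀ χ lam (B ×ˢ P) W := by
  set a : Fin n → Coord n × Coord r × Coord k → ℝ :=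
    fun l t => χ l (phiCoord e c x₀ t.1 t.2.1) (lam t.2.2) with ha
  have hχat : ∀ l, ∀ q ∈ c.target, ∀ j ∈ J,
      ContDiffAt ℝ ∞ (fun t : Coord r × Coord k => χ l t.1 (lam t.2)) (q, j) :=
    fun l q hq j hj => (hχ l).contDiffAt ((c.open_target.prod hJ).mem_nhds ⟨hq, hj⟩)
  have hasm : ∀ l, ContDiffOn ℝ ∞ (a l) (B ×ˢ P) := by
    rintro l ⟨x, q, j⟩ hz
    obtain ⟨hx, hq, hj, hφ⟩ := hBP hz
    have h1 := contDiffAt_phiCoord hst he x₀ hc hx hq hφ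
    have h2 : ContDiffAt ℝ ∞ (fun t : Coord n × Coord r × Coord k =>
        (phiCoord e c x₀ t.1 t.2.1, t.2.2)) (x, q, j) :=
      (ContDiffAt.comp (g := fun t : Coord n × Coord r => phiCoord e c x₀ t.1 t.2)
        (f := fun t : Coord n × Coord r × Coord k => (t.1, t.2.1)) (x, q, j) h1
        (by fun_prop)).prodMk (by fun_prop)
    exact (ContDiffAt.comp (g := fun t : Coord r × Coord k => χ l t.1 (lam t.2)) (x, q, j)
      (hχat l _ (c.map_source hφ) j hj) h2).contDiffWithinAt
  have hθ := contDiffOn_coframeForm hst he x₀ b (D := B ×ˢ P) (fun t ht => (hBP ht).1) hasm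
  have hsymm : ∀ x ∈ B, ∀ y ∈ P, ∀ v w,
      fderiv ℝ (fun x => coframeForm e b x₀ (fun l => a l (x, y)) x) x v w =
        fderiv ℝ (fun x => coframeForm e b x₀ (fun l => a l (x, y)) x) x w v := by
    rintro x hx ⟨q, j⟩ hqj
    obtain ⟨hxe, hq, hj, hφ⟩ := hBP (show (x, q, j) ∈ B ×ˢ P from ⟨hx, hqj⟩)
    have hφx : DifferentiableAt ℝ (fun x => phiCoord e c x₀ x q) x :=
      ((contDiffAt_phiCoord hst he x₀ hc hxe hq hφ).differentiableAt (by simp)).comp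
        (f := fun x => (x, q)) x (by fun_prop)
    have hφt : phiCoord e c x₀ x q ∈ c.target := c.map_source hφ
    have hχd : ∀ l, DifferentiableAt ℝ (fun q => χ l q (lam j)) (phiCoord e c x₀ x q) := fun l =>
      ((hχat l _ hφt j hj).differentiableAt (by simp)).comp
        (f := fun q => (q, j)) _ (by fun_prop)
    -- Differentiating χ_l ∘ φ along ξ_m is differentiating χ_l along ζ_m at φ.
    have had : ∀ l m, fderiv ℝ (fun x => a l (x, q, j)) x (frameVector e b x₀ m x) =
        fderiv ℝ (fun q => χ l q (lam j)) (phiCoord e c x₀ x q)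
          (zeta c b m (phiCoord e c x₀ x q)) := by
      intro l m
      have h1 := ((hχd l).hasFDerivAt.comp x hφx.hasFDerivAt).fderiv
      rw [← fderiv_phiCoord_frameVector hst he x₀ b hc hxe hq hφ m]
      exact congrArg (fun L => L (frameVector e b x₀ m x)) h1
    have hat : ContDiffAt ℝ ∞ (fun t : Coord n × Coord r × Coord k =>
        coframeForm e b x₀ (fun l => a l t) t.1) (x, q, j) :=
      hθ.contDiffAt ((hB.prod hP).mem_nhds ⟨hx, hqj⟩)
    refine fderiv_symm_of_frame (ξ := fun k => frameVector e b x₀ k)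
      (a := fun l x => a l (x, q, j)) ?_ ?_ ?_ ?_ ?_
    · exact (hat.differentiableAt (by simp)).comp (f := fun x => (x, q, j)) x (by fun_prop)
    · exact fun k => ((contDiffOn_frameVector hst he x₀ b k).contDiffAt
        (e.open_target.mem_nhds hxe)).differentiableAt (by simp)
    · intro l
      filter_upwards [e.open_target.mem_nhds hxe] with x' hx'
      rw [coframeForm_frameVector hst he x₀ b hx']
    · exact fun v => ⟨_, eq_sum_smul_frameVector hst he x₀ b hxe v⟩
    · intro i l
      -- Both sides equal C_{il}^s χ_s: the left one by the brackets of the f_i at p = 0, the right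
      -- one by the brackets of the frame.
      rw [had, had, (hf j hj).fderiv_sub_fderiv hφt,
        lieBracket_frameVector hst he x₀ b hxe, map_sum]
      refine Finset.sum_congr rfl fun m _ => ?_
      rw [map_smul, coframeForm_frameVector hst he x₀ b hxe, smul_eq_mul]
  obtain ⟨W, hW, hWd⟩ := exists_contDiffOn_primitive hB hconv hP
    (θ := fun x y => coframeForm e b x₀ (fun l => a l (x, y)) x) hθ hsymm
  refine ⟨fun x q j => W x (q, j), hB.prod hP, hW, fun x q j hz i => ?_⟩
  rw [partialDeriv, (hWd x hz.1 (q, j) hz.2).fderiv, coframeForm_apply]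
  simp [ha]

end Primitive

/-! ### Canonical coordinates give an immersion into 𝔤*. -/

section Orbits

theorem mulVec_eq_zero_of_rank_eq_card {m ι : Type*} [Fintype m] [Fintype ι] {A : Matrix m ι ℝ}
    (hA : A.rank = Fintype.card ι) {v : ι → ℝ} (hv : A.mulVec v = 0) : v = 0 := by
  classical
  have h := LinearMap.finrank_range_add_finrank_ker A.mulVecLin
  rw [Module.finrank_fintype_fun_eq_card] at h
  have hr : Module.finrank ℝ (LinearMap.range A.mulVecLin) = Fintype.card ι := hA
  have hker : LinearMap.ker A.mulVecLin = ⊥ := Submodule.finrank_eq_zero.mp (by omega)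
  exact (LinearMap.ker_eq_bot'.mp hker) v hv

variable {n k r : ℕ} {G : Type*} [TopologicalSpace G] [ChartedSpace (Coord n) G]
  [Group G] [LieGroup (𝓡 n) ∞ G] {H : Subgroup G}
  {c : OpenPartialHomeomorph (RightQuotient H) (Coord r)}
  {b : Module.Basis (Fin n) ℝ (GroupLieAlgebra (𝓡 n) G)}
  {χ : Fin n → Coord r → DualLie n G → ℝ} {J : Set (Coord k)} {lam : Coord k → DualLie n G}
  {T : Set (Coord k × Coord r × Coord r)}

/-- A regular μ attains the infimum that defines the index. -/
theorem orbitDim_eq_of_isRegular {μ : DualLie n G} (hμ : IsRegular b μ) :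
    orbitDim b μ + lieIndex b = n := by
  have hle : orbitDim b μ ≤ n := by
    simpa [orbitDim] using Matrix.rank_le_card_width (kirillovMatrix b μ)
  have h1 : lieIndex b ≤ n - orbitDim b μ := ciInf_le (OrderBot.bddBelow _) μ
  have h2 : n - orbitDim b μ ≤ lieIndex b := le_ciInf fun ν => Nat.sub_le_sub_left (hμ ν) n
  omega

/-- The functions `f_i(q, p; lam j)` of `(j, q, p)`. -/
def transitionFamily (c : OpenPartialHomeomorph (RightQuotient H) (Coord r))
    (b : Module.Basis (Fin n) ℝ (GroupLieAlgebra (𝓡 n) G)) (χ : Fin n → Coord r → DualLie n G → ℝ)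
    (lam : Coord k → DualLie n G) (i : Fin n) (t : Coord k × Coord r × Coord r) : ℝ :=
  transition c b χ (lam t.1) i t.2.1 t.2.2

variable (hJ : IsOpen J)
  (hχ : ∀ i, ContDiffOn ℝ ∞ (fun t : Coord r × Coord k => χ i t.1 (lam t.2)) (c.target ×ˢ J))
  (hT : IsOpen T) (hTV : ∀ t ∈ T, t.1 ∈ J ∧ t.2.1 ∈ c.target)
  (hf : ∀ j ∈ J, IsCanonicalTransition b (lam j) c.target {t | (j, t.1, t.2) ∈ T}
    (transition c b χ (lam j)))

include hJ hχ hf in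
theorem contDiffAt_transitionFamily (i : Fin n) {j : Coord k} (hj : j ∈ J) {q : Coord r}
    (hq : q ∈ c.target) (p : Coord r) :
    ContDiffAt ℝ ∞ (transitionFamily c b χ lam i) (j, q, p) := by
  have h1 : ContDiffAt ℝ ∞ (fun t : Coord k × Coord r × Coord r => χ i t.2.1 (lam t.1))
      (j, q, p) :=
    ContDiffAt.comp (g := fun t : Coord r × Coord k => χ i t.1 (lam t.2))
      (f := fun t : Coord k × Coord r × Coord r => (t.2.1, t.1)) (j, q, p)
      ((hχ i).contDiffAt ((c.open_target.prod hJ).mem_nhds ⟨hq, hj⟩)) (by fun_prop)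
  have h2 : ∀ a, ContDiffAt ℝ ∞ (fun t : Coord k × Coord r × Coord r => zeta c b i t.2.1 a)
      (j, q, p) := fun a =>
    ContDiffAt.comp (g := fun q => zeta c b i q a)
      (f := fun t : Coord k × Coord r × Coord r => t.2.1) (j, q, p)
      (((hf j hj).contDiffOn_zeta i a).contDiffAt (c.open_target.mem_nhds hq)) (by fun_prop)
  unfold transitionFamily transition
  exact (ContDiffAt.sum fun a _ => (h2 a).mul (by fun_prop)).add h1

/-- The basis of `𝔤*` that is dual to `b`. -/
def dualCovector (b : Module.Basis (Fin n) ℝ (GroupLieAlgebra (𝓡 n) G)) (i : Fin n) :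
    DualLie n G :=
  LinearMap.toContinuousLinearMap (E := Coord n) (F' := ℝ) (b.coord i)

/-- The linear functional with the given components in the basis dual to `b`. -/
def ofComponents (b : Module.Basis (Fin n) ℝ (GroupLieAlgebra (𝓡 n) G)) (a : Fin n → ℝ) :
    DualLie n G :=
  ∑ i, a i • dualCovector b i

theorem ofComponents_apply_basis (ν : DualLie n G) : ofComponents b (fun i => ν (b i)) = ν := by
  have h : ∀ X : GroupLieAlgebra (𝓡 n) G, ofComponents b (fun i => ν (b i)) X = ν X := by
    intro X
    have h1 : ν X = ∑ i, b.repr X i * ν (b i) := by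
      conv_lhs => rw [← b.sum_repr X]
      refine (map_sum ν _ _).trans (Finset.sum_congr rfl fun i _ => ?_)
      exact map_smul ν _ _
    rw [h1, ofComponents]
    refine (sum_apply _ _ _).trans (Finset.sum_congr rfl fun i _ => ?_)
    exact mul_comm _ _
  exact ContinuousLinearMap.ext h

include hJ hχ hT hTV hf in
/-- The map `(j, q, p) ↦ f(q, p; lam j) ∈ 𝔤*` is an immersion on `T`. -/
theorem eq_zero_of_fderiv_transitionFamily (hk : k = lieIndex b) (hr : 2 * r + k = n)
    (hlam : IsOrbitParametrization b J lam) {t δ : Coord k × Coord r × Coord r} (ht : t ∈ T)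
    (hδ : ∀ i, fderiv ℝ (transitionFamily c b χ lam i) t δ = 0) : δ = 0 := by
  obtain ⟨U, K, hU, hUinv, hK, -, hfib, hsec⟩ := hlam.fibration
  have hd : ∀ s ∈ T, ∀ i, DifferentiableAt ℝ (transitionFamily c b χ lam i) s := fun s hs i =>
    (contDiffAt_transitionFamily hJ hχ hf i (hTV s hs).1 (hTV s hs).2 s.2.2).differentiableAt
      (by simp)
  set N : Coord k × Coord r × Coord r → DualLie n G :=
    fun s => ofComponents b fun i => transitionFamily c b χ lam i s with hN
  have hNd : HasFDerivAt N (∑ i, (fderiv ℝ (transitionFamily c b χ lam i) t).smulRight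
      (dualCovector b i)) t := by
    simp only [hN, ofComponents]
    exact HasFDerivAt.fun_sum fun i _ => HasFDerivAt.smul_const (F := DualLie n G) (hd t ht i).hasFDerivAt (dualCovector b i)
  -- Points of T are sent to the orbit of λ(j), which lies in U by invariance; K is constant on that
  -- orbit, with value j.
  have hNT : ∀ s ∈ T, N s ∈ U ∧ K (N s) = s.1 := by
    intro s hs
    obtain ⟨hj, hq⟩ := hTV s hs
    obtain ⟨ν, hν, hνs⟩ := (hf s.1 hj).mem_orbit s.2.1 s.2.2 hs
    have h1 : N s = ν := by
      rw [← ofComponents_apply_basis (b := b) ν]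
      exact congrArg (ofComponents b) (funext hνs)
    obtain ⟨hl, hKl⟩ := hsec s.1 hj
    have hνU : ν ∈ U := by
      obtain ⟨z, rfl⟩ := hν
      exact hUinv z _ hl
    rw [h1]
    exact ⟨hνU, ((hfib _ hl _ hνU).mpr hν).symm.trans hKl⟩
  have hKd : DifferentiableAt ℝ K (N t) :=
    (hK.contDiffAt (hU.mem_nhds (hNT t ht).1)).differentiableAt (by simp)
  -- As K ∘ N is the projection to j near t, a vector killed by dN has no j-component.
  have hcomp : HasFDerivAt (K ∘ N) (ContinuousLinearMap.fst ℝ (Coord k) (Coord r × Coord r)) t := by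
    refine hasFDerivAt_fst.congr_of_eventuallyEq ?_
    filter_upwards [hT.mem_nhds ht] with s hs using (hNT s hs).2
  have hδ1 : δ.1 = 0 := by
    have h1 := congrArg (fun L => L δ) (hcomp.unique (hKd.hasFDerivAt.comp t hNd))
    simpa [hδ, sum_apply] using h1
  obtain ⟨j, q, p⟩ := t
  obtain ⟨δj, δq, δp⟩ := δ
  obtain ⟨hj, hq⟩ := hTV _ ht
  have hrank := (hf j hj).rank q p ht
  have hdim := orbitDim_eq_of_isRegular (hlam.regular j hj)
  -- For fixed j, the Jacobi matrix in (q, p) has rank n - ind 𝔤 = 2r, its number of columns, so the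
  -- remaining components vanish too.
  have hv := mulVec_eq_zero_of_rank_eq_card (v := Sum.elim δq δp)
    (hrank.trans (by simp; omega)) (by
      ext i
      have h1 := hδ i
      have hδj : δj = 0 := hδ1
      have hsplit : ((δj, δq, δp) : Coord k × Coord r × Coord r) = (0, δq, 0) + (0, 0, δp) := by
        simp [hδj]
      have hq' : HasFDerivAt (fun q' => transition c b χ (lam j) i q' p)
          ((fderiv ℝ (transitionFamily c b χ lam i) (j, q, p)).comp
            ((ContinuousLinearMap.inr ℝ (Coord k) (Coord r × Coord r)).comp
              (ContinuousLinearMap.inl ℝ (Coord r) (Coord r)))) q :=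
        HasFDerivAt.comp (g := transitionFamily c b χ lam i) (f := fun q' => (j, q', p)) q
          (hd _ ht i).hasFDerivAt
          ((hasFDerivAt_prodMk_right j (q, p)).comp q (hasFDerivAt_prodMk_left q p))
      have hp' : HasFDerivAt (fun p' => transition c b χ (lam j) i q p')
          ((fderiv ℝ (transitionFamily c b χ lam i) (j, q, p)).comp
            ((ContinuousLinearMap.inr ℝ (Coord k) (Coord r × Coord r)).comp
              (ContinuousLinearMap.inr ℝ (Coord r) (Coord r)))) p :=
        HasFDerivAt.comp (g := transitionFamily c b χ lam i) (f := fun p' => (j, q, p')) p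
          (hd _ ht i).hasFDerivAt
          ((hasFDerivAt_prodMk_right j (q, p)).comp p (hasFDerivAt_prodMk_right q p))
      have eq := fderiv_apply_eq_sum_partialDeriv (fun q' => transition c b χ (lam j) i q' p) q δq
      have ep := fderiv_apply_eq_sum_partialDeriv (fun p' => transition c b χ (lam j) i q p') p δp
      rw [hq'.fderiv] at eq
      rw [hp'.fderiv] at ep
      rw [hsplit, map_add] at h1
      simp only [Matrix.mulVec, dotProduct, Fintype.sum_sum_type, Matrix.of_apply, Sum.elim_inl,
        Sum.elim_inr, Pi.zero_apply]
      rw [← h1]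
      refine congrArg₂ (· + ·) ?_ ?_
      · refine Eq.trans ?_ eq.symm
        exact Finset.sum_congr rfl fun a _ => mul_comm _ _
      · refine Eq.trans ?_ ep.symm
        exact Finset.sum_congr rfl fun a _ => mul_comm _ _)
  refine Prod.ext hδ1 (Prod.ext ?_ ?_)
  · ext a
    exact congrFun hv (Sum.inl a)
  · ext a
    exact congrFun hv (Sum.inr a)

end Orbits

/-! ### The gradient of the reduced complete integral. -/

section Gradient

variable {k r : ℕ}

/-- The gradient in `q` of a family of functions `S(q; j, β)`. -/
def gradFamily (S : Coord k → Coord r → Coord r → ℝ) (t : Coord k × Coord r × Coord r) : Coord r :=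
  grad (fun q => S t.1 q t.2.2) t.2.1

variable {S : Coord k → Coord r → Coord r → ℝ} {Ω : Set (Coord k × Coord r × Coord r)}

/-- One derivative of S is spent on the gradient and one more is needed to differentiate it, whence
2 ≤ N. -/
theorem contDiffAt_gradFamily {N : WithTop ℕ∞} (hN : 2 ≤ N) (hΩ : IsOpen Ω)
    (hS : ContDiffOn ℝ N (fun t : Coord k × Coord r × Coord r => S t.1 t.2.1 t.2.2) Ω)
    {t : Coord k × Coord r × Coord r} (ht : t ∈ Ω) : ContDiffAt ℝ 1 (gradFamily S) t := by
  rw [contDiffAt_euclidean]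
  intro a
  have hat : ∀ s ∈ Ω, ContDiffAt ℝ N (fun t : Coord k × Coord r × Coord r => S t.1 t.2.1 t.2.2) s :=
    fun s hs => hS.contDiffAt (hΩ.mem_nhds hs)
  have h1 : ContDiffAt ℝ 1 (fun s =>
      fderiv ℝ (fun t : Coord k × Coord r × Coord r => S t.1 t.2.1 t.2.2) s
        (0, EuclideanSpace.single a 1, 0)) t :=
    ((hat t ht).fderiv_right (m := 1) (by rwa [one_add_one_eq_two])).clm_apply contDiffAt_const
  refine h1.congr_of_eventuallyEq ?_
  filter_upwards [hΩ.mem_nhds ht] with s hs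
  have h2 : HasFDerivAt (fun q => S s.1 q s.2.2) _ s.2.1 :=
    HasFDerivAt.comp (g := fun t : Coord k × Coord r × Coord r => S t.1 t.2.1 t.2.2)
      (f := fun q => (s.1, q, s.2.2)) s.2.1
      ((hat s hs).differentiableAt (zero_lt_two.trans_le hN).ne').hasFDerivAt
      ((hasFDerivAt_prodMk_right s.1 s.2).comp s.2.1 (hasFDerivAt_prodMk_left s.2.1 s.2.2))
  change partialDeriv _ a s.2.1 = _
  rw [partialDeriv, h2.fderiv]
  rfl

/-- The β-derivative of the gradient is the mixed Hessian of S, which is invertible for a complete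
integral. -/
theorem eq_zero_of_fderiv_gradFamily {F : Coord r → Coord r → ℝ} {m : Coord r → ℝ}
    {N : WithTop ℕ∞} {t : Coord k × Coord r × Coord r} (ht : t ∈ Ω)
    (hS : IsCompleteIntegral N F m {s | (t.1, s.1, s.2) ∈ Ω} (S t.1))
    (hd : DifferentiableAt ℝ (gradFamily S) t) {δ : Coord r}
    (hδ : fderiv ℝ (gradFamily S) t (0, 0, δ) = 0) : δ = 0 := by
  obtain ⟨v, hv⟩ := hS.nondegenerate
  have hdet := hv t.2.1 t.2.2 ht
  have hpart : ∀ i u, fderiv ℝ (fun β => partialDeriv (fun q => S t.1 q β) i t.2.1) t.2.2 u =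
      fderiv ℝ (gradFamily S) t (0, 0, u) i := by
    intro i u
    have h1 : HasFDerivAt (fun β => partialDeriv (fun q => S t.1 q β) i t.2.1)
        ((EuclideanSpace.proj (𝕜 := ℝ) i).comp ((fderiv ℝ (gradFamily S) t).comp
          ((ContinuousLinearMap.inr ℝ (Coord k) (Coord r × Coord r)).comp
            (ContinuousLinearMap.inr ℝ (Coord r) (Coord r))))) t.2.2 :=
      (EuclideanSpace.proj (𝕜 := ℝ) i).hasFDerivAt.comp t.2.2
        (HasFDerivAt.comp (g := gradFamily S) (f := fun β => (t.1, t.2.1, β)) t.2.2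
          hd.hasFDerivAt
          ((hasFDerivAt_prodMk_right t.1 t.2).comp t.2.2 (hasFDerivAt_prodMk_right t.2.1 t.2.2)))
    rw [h1.fderiv]
    rfl
  have hrepr : (v.repr δ : Fin r → ℝ) = 0 := by
    by_contra hne
    refine hdet (Matrix.exists_mulVec_eq_zero_iff.mp ⟨_, hne, ?_⟩)
    ext i
    have h2 := hpart i δ
    rw [hδ] at h2
    conv_lhs at h2 => rw [← v.sum_repr δ]
    rw [map_sum] at h2
    simp only [map_smul, smul_eq_mul, PiLp.zero_apply] at h2
    simp only [Matrix.mulVec, dotProduct, Matrix.of_apply, Pi.zero_apply]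
    rw [← h2]
    exact Finset.sum_congr rfl fun l _ => mul_comm _ _
  have h3 : v.repr δ = 0 := DFunLike.coe_injective hrepr
  exact (LinearEquiv.map_eq_zero_iff v.repr).mp h3

end Gradient

/-! ### The function S on M. -/

section CompleteIntegral

variable {n k r : ℕ} {G : Type*} [TopologicalSpace G] [ChartedSpace (Coord n) G]
  {M : Type*} [TopologicalSpace M] [ChartedSpace (Coord n) M]
  [Group G] [LieGroup (𝓡 n) ∞ G] [IsManifold (𝓡 n) ∞ M]
  [MulAction G M] [ContMDiffSMul (𝓡 n) (𝓡 n) ∞ G M] {e : OpenPartialHomeomorph M (Coord n)}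
  (hst : SimplyTransitive G M) (he : e ∈ IsManifold.maximalAtlas (𝓡 n) ∞ M) (x₀ : M)
  (b : Module.Basis (Fin n) ℝ (GroupLieAlgebra (𝓡 n) G)) {H : Subgroup G}
  {c : OpenPartialHomeomorph (RightQuotient H) (Coord r)} (hc : IsSmoothChart (n := n) c)
  {χ : Fin n → Coord r → DualLie n G → ℝ} {J : Set (Coord k)} {lam : Coord k → DualLie n G}

include hst he in
/-- The geodesic symbol, expressed through the values of a covector on the invariant frame. -/
theorem geodesicSymbol_eq_sum {g : PseudoRiemannianMetric n M} (hG : ActsByIsometries G g)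
    {x : Coord n} (hx : x ∈ e.target) (p : Coord n) {f : Fin n → ℝ}
    (hfp : ∀ k, ∑ i, frameMatrix e b x₀ x i k * p i = f k) :
    geodesicSymbol g e x p = ∑ i, ∑ j, (gramMatrix g b x₀)⁻¹ i j * f i * f j := by
  -- f = Fᵀ p, with F the frame matrix; hence pᵀ F 𝐆⁻¹ Fᵀ p = fᵀ 𝐆⁻¹ f.
  have hF : (frameMatrix e b x₀ x).transpose.mulVec (fun i => p i) = f := funext hfp
  have hquad : ∀ (A : Matrix (Fin n) (Fin n) ℝ) (w : Fin n → ℝ),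
      ∑ i, ∑ j, A i j * w i * w j = dotProduct w (A.mulVec w) := by
    intro A w
    simp only [dotProduct, Matrix.mulVec, Finset.mul_sum]
    exact Finset.sum_congr rfl fun i _ => Finset.sum_congr rfl fun j _ => by ring
  rw [geodesicSymbol, hquad _ (fun i => p i), hquad, inv_metricMatrix hst he x₀ b hG hx,
    ← Matrix.mulVec_mulVec, ← Matrix.mulVec_mulVec, hF, Matrix.dotProduct_mulVec,
    ← Matrix.mulVec_transpose, hF]

variable {D : Set (Coord n × Coord r × Coord k)} {W : Coord n → Coord r → Coord k → ℝ}
  {N : WithTop ℕ∞} {S : Coord k → Coord r → Coord r → ℝ}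
  {Ω : Set (Coord k × Coord r × Coord r)}

/-- The function `S̃_j(φ(x, q); β) + ∫ χ_l(φ(x, q); lam j) ω^l(x)` of `x` and `α = (q, j, β)`. -/
def liftedIntegral (e : OpenPartialHomeomorph M (Coord n))
    (c : OpenPartialHomeomorph (RightQuotient H) (Coord r)) (x₀ : M)
    (S : Coord k → Coord r → Coord r → ℝ) (W : Coord n → Coord r → Coord k → ℝ)
    (x : Coord n) (α : Coord r × Coord k × Coord r) : ℝ :=
  S α.2.1 (phiCoord e c x₀ x α.1) α.2.2 + W x α.1 α.2.1

/-- The domain of `liftedIntegral`. -/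
def liftedDomain (e : OpenPartialHomeomorph M (Coord n))
    (c : OpenPartialHomeomorph (RightQuotient H) (Coord r)) (x₀ : M)
    (D : Set (Coord n × Coord r × Coord k)) (Ω : Set (Coord k × Coord r × Coord r)) :
    Set (Coord n × Coord r × Coord k × Coord r) :=
  {t | (t.1, t.2.1, t.2.2.1) ∈ D ∧ (t.2.2.1, phiCoord e c x₀ t.1 t.2.1, t.2.2.2) ∈ Ω}

variable (hD : D ⊆ formDomain e c x₀ J) (hW : IsPrimitive N e c b x₀ χ lam D W) (hN : 2 ≤ N)
  (hΩ : IsOpen Ω)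
  (hS : ContDiffOn ℝ N (fun t : Coord k × Coord r × Coord r => S t.1 t.2.1 t.2.2) Ω)

include hst he hc hD in
theorem contDiffAt_reducedPoint {t : Coord n × Coord r × Coord k × Coord r}
    (ht : (t.1, t.2.1, t.2.2.1) ∈ D) :
    ContDiffAt ℝ ∞ (fun t : Coord n × Coord r × Coord k × Coord r =>
      (t.2.2.1, phiCoord e c x₀ t.1 t.2.1, t.2.2.2)) t := by
  obtain ⟨hx, hq, -, hφ⟩ := hD ht
  have h1 : ContDiffAt ℝ ∞ (fun t : Coord n × Coord r × Coord k × Coord r =>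
      phiCoord e c x₀ t.1 t.2.1) t :=
    ContDiffAt.comp (g := fun t : Coord n × Coord r => phiCoord e c x₀ t.1 t.2)
      (f := fun t : Coord n × Coord r × Coord k × Coord r => (t.1, t.2.1)) t
      (contDiffAt_phiCoord hst he x₀ hc hx hq hφ) (by fun_prop)
  exact ContDiffAt.prodMk (by fun_prop) (h1.prodMk (by fun_prop))

include hst he hc hD hW hΩ in
theorem isOpen_liftedDomain : IsOpen (liftedDomain e c x₀ D Ω) := by
  have hopen : IsOpen {t : Coord n × Coord r × Coord k × Coord r | (t.1, t.2.1, t.2.2.1) ∈ D} :=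
    hW.isOpen.preimage (by fun_prop)
  exact ContinuousOn.isOpen_inter_preimage
    (fun t ht => (contDiffAt_reducedPoint hst he x₀ hc hD ht).continuousAt.continuousWithinAt)
    hopen hΩ

include hst he hc hD hW hΩ hS in
theorem contDiffOn_liftedIntegral (hN' : N ≤ ∞) :
    ContDiffOn ℝ N (fun t : Coord n × Coord r × Coord k × Coord r =>
      liftedIntegral e c x₀ S W t.1 t.2) (liftedDomain e c x₀ D Ω) := by
  rintro t ⟨htD, htΩ⟩
  have h1 := ContDiffAt.comp (g := fun t : Coord k × Coord r × Coord r => S t.1 t.2.1 t.2.2) t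
    (hS.contDiffAt (hΩ.mem_nhds htΩ)) ((contDiffAt_reducedPoint hst he x₀ hc hD htD).of_le hN')
  have h2 := ContDiffAt.comp (g := fun t : Coord n × Coord r × Coord k => W t.1 t.2.1 t.2.2)
    (f := fun t : Coord n × Coord r × Coord k × Coord r => (t.1, t.2.1, t.2.2.1)) t
    (hW.contDiffOn.contDiffAt (hW.isOpen.mem_nhds htD)) (by fun_prop)
  exact (h1.add h2).contDiffWithinAt

include hst he hc hD hW hN hΩ hS in
/-- The derivative of `S` along `ξ_k` is `f_k`. -/
theorem fderiv_liftedIntegral {x : Coord n} {α : Coord r × Coord k × Coord r}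
    (ht : (x, α) ∈ liftedDomain e c x₀ D Ω) :
    fderiv ℝ (fun x => liftedIntegral e c x₀ S W x α) x = coframeForm e b x₀ (fun l =>
      transitionFamily c b χ lam l (α.2.1, phiCoord e c x₀ x α.1,
        gradFamily S (α.2.1, phiCoord e c x₀ x α.1, α.2.2))) x := by
  obtain ⟨htD, htΩ⟩ := ht
  obtain ⟨hx, hq, -, hφ⟩ := hD htD
  have hN0 : N ≠ 0 := (zero_lt_two.trans_le hN).ne'
  set φ := phiCoord e c x₀ x α.1 with hφdef
  have hφx : DifferentiableAt ℝ (fun x => phiCoord e c x₀ x α.1) x :=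
    ((contDiffAt_phiCoord hst he x₀ hc hx hq hφ).differentiableAt (by simp)).comp
      (f := fun x => (x, α.1)) x (by fun_prop)
  have hSd : DifferentiableAt ℝ (fun q => S α.2.1 q α.2.2) φ :=
    ((hS.contDiffAt (hΩ.mem_nhds htΩ)).differentiableAt hN0).comp
      (f := fun q => (α.2.1, q, α.2.2)) φ (by fun_prop)
  have hWd : DifferentiableAt ℝ (fun x => W x α.1 α.2.1) x :=
    ((hW.contDiffOn.contDiffAt (hW.isOpen.mem_nhds htD)).differentiableAt hN0).comp
      (f := fun x => (x, α.1, α.2.1)) x (by fun_prop)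
  have hWf : ∀ v, fderiv ℝ (fun x => W x α.1 α.2.1) x v =
      coframeForm e b x₀ (fun l => χ l φ (lam α.2.1)) x v := by
    intro v
    rw [fderiv_apply_eq_sum_partialDeriv, coframeForm_apply]
    refine Finset.sum_congr rfl fun i _ => ?_
    rw [hW.differential x α.1 α.2.1 htD i, mul_comm]
  have hder : HasFDerivAt (fun x => liftedIntegral e c x₀ S W x α)
      ((fderiv ℝ (fun q => S α.2.1 q α.2.2) φ).comp (fderiv ℝ (fun x => phiCoord e c x₀ x α.1) x) +
        fderiv ℝ (fun x => W x α.1 α.2.1) x) x :=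
    HasFDerivAt.add (f := fun x => S α.2.1 (phiCoord e c x₀ x α.1) α.2.2)
      (HasFDerivAt.comp (g := fun q => S α.2.1 q α.2.2) x hSd.hasFDerivAt hφx.hasFDerivAt)
      hWd.hasFDerivAt
  have hframe : ∀ l, fderiv ℝ (fun x => liftedIntegral e c x₀ S W x α) x (frameVector e b x₀ l x) =
      transitionFamily c b χ lam l (α.2.1, φ, gradFamily S (α.2.1, φ, α.2.2)) := by
    intro l
    rw [hder.fderiv]
    change fderiv ℝ (fun q => S α.2.1 q α.2.2) φ
      (fderiv ℝ (fun x => phiCoord e c x₀ x α.1) x (frameVector e b x₀ l x)) +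
        fderiv ℝ (fun x => W x α.1 α.2.1) x (frameVector e b x₀ l x) = _
    rw [fderiv_phiCoord_frameVector hst he x₀ b hc hx hq hφ, hWf,
      coframeForm_frameVector hst he x₀ b hx, fderiv_apply_eq_sum_partialDeriv]
    rfl
  -- Two covectors that agree on the frame are equal.
  ext v
  rw [eq_sum_smul_frameVector hst he x₀ b hx v]
  simp only [map_sum, map_smul, hframe, coframeForm_frameVector hst he x₀ b hx]


include hst he hc hD in
-- The differential is block triangular: the first component gives δj = 0, the second gives δq = 0
-- since ρ_z is a local diffeomorphism, and what remains of the third is the mixed Hessian of S̃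
-- applied to δβ.
theorem eq_zero_of_fderiv_reducedPoint {F : Coord k → Coord r → Coord r → ℝ}
    {m : Coord k → Coord r → ℝ}
    (hSc : ∀ j ∈ J, IsCompleteIntegral N (F j) (m j) {t | (j, t.1, t.2) ∈ Ω} (S j))
    {x : Coord n} {α : Coord r × Coord k × Coord r} (ht : (x, α) ∈ liftedDomain e c x₀ D Ω)
    (hd : DifferentiableAt ℝ (gradFamily S) (α.2.1, phiCoord e c x₀ x α.1, α.2.2))
    {δ : Coord r × Coord k × Coord r}
    (hδ : fderiv ℝ (fun α : Coord r × Coord k × Coord r => (α.2.1, phiCoord e c x₀ x α.1,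
      gradFamily S (α.2.1, phiCoord e c x₀ x α.1, α.2.2))) α δ = 0) : δ = 0 := by
  obtain ⟨htD, htΩ⟩ := ht
  obtain ⟨hx, hq, hj, hφ⟩ := hD htD
  obtain ⟨q, j, β⟩ := α
  obtain ⟨δq, δj, δβ⟩ := δ
  set Φ := fderiv ℝ (fun q => phiCoord e c x₀ x q) q with hΦ
  have hφd : HasFDerivAt (fun q => phiCoord e c x₀ x q) Φ q :=
    (((contDiffAt_phiCoord hst he x₀ hc hx hq hφ).differentiableAt (by simp)).comp
      (f := fun q => (x, q)) q (by fun_prop)).hasFDerivAt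
  have h1 : HasFDerivAt (fun α : Coord r × Coord k × Coord r => α.2.1)
      ((ContinuousLinearMap.fst ℝ (Coord k) (Coord r)).comp
        (ContinuousLinearMap.snd ℝ (Coord r) (Coord k × Coord r))) (q, j, β) :=
    hasFDerivAt_fst.comp (q, j, β) hasFDerivAt_snd
  have h2 : HasFDerivAt (fun α : Coord r × Coord k × Coord r => phiCoord e c x₀ x α.1)
      (Φ.comp (ContinuousLinearMap.fst ℝ (Coord r) (Coord k × Coord r))) (q, j, β) :=
    HasFDerivAt.comp (g := fun q => phiCoord e c x₀ x q) (q, j, β) hφd hasFDerivAt_fst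
  have h3 : HasFDerivAt (fun α : Coord r × Coord k × Coord r => α.2.2)
      ((ContinuousLinearMap.snd ℝ (Coord k) (Coord r)).comp
        (ContinuousLinearMap.snd ℝ (Coord r) (Coord k × Coord r))) (q, j, β) :=
    hasFDerivAt_snd.comp (q, j, β) hasFDerivAt_snd
  have h4 := HasFDerivAt.comp (g := gradFamily S) (q, j, β) hd.hasFDerivAt
    (h1.prodMk (h2.prodMk h3))
  have h5 : HasFDerivAt (fun α : Coord r × Coord k × Coord r => (α.2.1, phiCoord e c x₀ x α.1,
      gradFamily S (α.2.1, phiCoord e c x₀ x α.1, α.2.2))) _ (q, j, β) :=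
    h1.prodMk (h2.prodMk h4)
  rw [h5.fderiv] at hδ
  have e1 : δj = 0 := congrArg Prod.fst hδ
  have e2 : Φ δq = 0 := congrArg (fun t => t.2.1) hδ
  have e3 : fderiv ℝ (gradFamily S) (j, phiCoord e c x₀ x q, β) (δj, Φ δq, δβ) = 0 :=
    congrArg (fun t => t.2.2) hδ
  have e4 : δq = 0 :=
    fderiv_actionCoord_injective hc hq hφ (e2.trans (map_zero Φ).symm)
  rw [e1, e2] at e3
  have e5 : δβ = 0 := eq_zero_of_fderiv_gradFamily htΩ (hSc j hj) hd e3
  rw [e1, e4, e5]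
  rfl

end CompleteIntegral

end GeodesicHJ

end

/-! ### The theorem. -/

theorem theorem1 {n k r : ℕ}
    {G : Type*} [TopologicalSpace G] [T2Space G] [ChartedSpace (GeodesicHJ.Coord n) G] [Group G]
    [LieGroup (𝓡 n) ∞ G]
    {M : Type*} [TopologicalSpace M] [T2Space M] [ChartedSpace (GeodesicHJ.Coord n) M]
    [IsManifold (𝓡 n) ∞ M]
    [MulAction G M] [ContMDiffSMul (𝓡 n) (𝓡 n) ∞ G M]
    (g : GeodesicHJ.PseudoRiemannianMetric n M)
    (hG : GeodesicHJ.ActsByIsometries G g) (hst : GeodesicHJ.SimplyTransitive G M) (x₀ : M)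
    (b : Module.Basis (Fin n) ℝ (GroupLieAlgebra (𝓡 n) G))
    -- `k = ind 𝔤` and `r = (dim 𝔤 - ind 𝔤) / 2`
    (hk : k = GeodesicHJ.lieIndex b) (hr : 2 * r + k = n)
    -- the parametrization of regular coadjoint orbits
    (J : Set (GeodesicHJ.Coord k)) (lam : GeodesicHJ.Coord k → GeodesicHJ.DualLie n G)
    (hlam : GeodesicHJ.IsOrbitParametrization b J lam)
    -- the polarization and the closed subgroup
    (𝔥 : LieSubalgebra ℝ (GroupLieAlgebra (𝓡 n) G))
    (hpol : ∀ j ∈ J, GeodesicHJ.IsPolarization b 𝔥 (lam j))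
    (H : Subgroup G) (hclosed : IsClosed (H : Set G)) (hH : GeodesicHJ.IsLieAlgebraOf 𝔥 H)
    -- local coordinates on `M` and on `Q = H \ G`
    (e : OpenPartialHomeomorph M (GeodesicHJ.Coord n))
    (he : e ∈ IsManifold.maximalAtlas (𝓡 n) ∞ M)
    (c : OpenPartialHomeomorph (GeodesicHJ.RightQuotient H) (GeodesicHJ.Coord r))
    (hc : GeodesicHJ.IsSmoothChart (n := n) c)
    -- the transition to canonical coordinates `(p, q)` on the orbits, for `(j, q, p) ∈ T`
    (χ : Fin n → GeodesicHJ.Coord r → GeodesicHJ.DualLie n G → ℝ)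
    (hχ : ∀ i, ContDiffOn ℝ ∞ (fun t : GeodesicHJ.Coord r × GeodesicHJ.Coord k =>
      χ i t.1 (lam t.2)) (c.target ×ˢ J))
    (T : Set (GeodesicHJ.Coord k × GeodesicHJ.Coord r × GeodesicHJ.Coord r)) (hT : IsOpen T)
    (hTV : ∀ t ∈ T, t.1 ∈ J ∧ t.2.1 ∈ c.target)
    (hf : ∀ j ∈ J, GeodesicHJ.IsCanonicalTransition b (lam j) c.target {t | (j, t.1, t.2) ∈ T}
      (GeodesicHJ.transition c b χ (lam j))) :
    -- the integral in the formula for `S` exists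
    (∀ (B : Set (GeodesicHJ.Coord n)) (P : Set (GeodesicHJ.Coord r × GeodesicHJ.Coord k)),
      IsOpen B → Convex ℝ B → IsOpen P → B ×ˢ P ⊆ GeodesicHJ.formDomain e c x₀ J →
      ∃ W, GeodesicHJ.IsPrimitive ∞ e c b x₀ χ lam (B ×ˢ P) W) ∧
    -- and `S` is a complete integral
    ∀ (N : WithTop ℕ∞), 2 ≤ N → N ≤ ∞ →
    ∀ (m : GeodesicHJ.Coord k → GeodesicHJ.Coord r → ℝ)
      (Ω : Set (GeodesicHJ.Coord k × GeodesicHJ.Coord r × GeodesicHJ.Coord r))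
      (St : GeodesicHJ.Coord k → GeodesicHJ.Coord r → GeodesicHJ.Coord r → ℝ),
      IsOpen Ω → (∀ j q β, (j, q, β) ∈ Ω →
        (j, q, GeodesicHJ.grad (fun q' => St j q' β) q) ∈ T) →
      ContDiffOn ℝ N (fun t : GeodesicHJ.Coord k × GeodesicHJ.Coord r × GeodesicHJ.Coord r =>
        St t.1 t.2.1 t.2.2) Ω →
      (∀ j ∈ J, GeodesicHJ.IsCompleteIntegral N (GeodesicHJ.reducedSymbol g c b x₀ χ (lam j))
        (m j) {t | (j, t.1, t.2) ∈ Ω} (St j)) →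
    ∀ (D : Set (GeodesicHJ.Coord n × GeodesicHJ.Coord r × GeodesicHJ.Coord k))
      (W : GeodesicHJ.Coord n → GeodesicHJ.Coord r → GeodesicHJ.Coord k → ℝ),
      D ⊆ GeodesicHJ.formDomain e c x₀ J →
      GeodesicHJ.IsPrimitive N e c b x₀ χ lam D W →
      GeodesicHJ.IsCompleteIntegral
        (A := GeodesicHJ.Coord r × GeodesicHJ.Coord k × GeodesicHJ.Coord r) N
        (GeodesicHJ.geodesicSymbol g e)
        (fun α => m α.2.1 α.2.2)
        {t | (t.1, t.2.1, t.2.2.1) ∈ D ∧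
          (t.2.2.1, GeodesicHJ.phiCoord e c x₀ t.1 t.2.1, t.2.2.2) ∈ Ω}
        (fun x α => St α.2.1 (GeodesicHJ.phiCoord e c x₀ x α.1) α.2.2 + W x α.1 α.2.1) := by
  refine ⟨fun B P hB hconv hP hBP => GeodesicHJ.exists_isPrimitive hst he x₀ b hc hlam.isOpen hχ hf
    hB hconv hP hBP, ?_⟩
  intro N hN hN' m Ω S hΩ hΩT hS hSc D W hD hW
  have hnondeg : ∀ x α, (x, α) ∈ GeodesicHJ.liftedDomain e c x₀ D Ω →
      ∀ δ : GeodesicHJ.Coord r × GeodesicHJ.Coord k × GeodesicHJ.Coord r,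
      (∀ i, fderiv ℝ (fun α' => GeodesicHJ.partialDeriv
        (fun x' => GeodesicHJ.liftedIntegral e c x₀ S W x' α') i x) α δ = 0) → δ = 0 := by
    intro x α ht δ hδ
    obtain ⟨hx, -, hj, hφ⟩ := hD ht.1
    have hgd : DifferentiableAt ℝ (GeodesicHJ.gradFamily S)
        (α.2.1, GeodesicHJ.phiCoord e c x₀ x α.1, α.2.2) :=
      (GeodesicHJ.contDiffAt_gradFamily hN hΩ hS ht.2).differentiableAt (by simp)
    refine GeodesicHJ.eq_zero_of_fderiv_reducedPoint hst he x₀ hc hD hSc ht hgd ?_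
    -- The map α ↦ f factors through Ψ; the two immersion statements are applied to Ψ and to the
    -- functions f_l at the point Ψ(α) of T.
    set Ψ : GeodesicHJ.Coord r × GeodesicHJ.Coord k × GeodesicHJ.Coord r →
        GeodesicHJ.Coord k × GeodesicHJ.Coord r × GeodesicHJ.Coord r := fun α =>
      (α.2.1, GeodesicHJ.phiCoord e c x₀ x α.1,
        GeodesicHJ.gradFamily S (α.2.1, GeodesicHJ.phiCoord e c x₀ x α.1, α.2.2)) with hΨ
    have hred : DifferentiableAt ℝ (fun α : GeodesicHJ.Coord r × GeodesicHJ.Coord k ×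
        GeodesicHJ.Coord r => (α.2.1, GeodesicHJ.phiCoord e c x₀ x α.1, α.2.2)) α :=
      DifferentiableAt.comp (f := fun α => (x, α)) α
        ((GeodesicHJ.contDiffAt_reducedPoint hst he x₀ hc hD ht.1).differentiableAt (by simp))
        (by fun_prop)
    have hΨd : DifferentiableAt ℝ Ψ α :=
      hred.fst.prodMk (hred.snd.fst.prodMk (DifferentiableAt.comp (g := GeodesicHJ.gradFamily S) α hgd hred))
    have hΨT : Ψ α ∈ T := hΩT _ _ _ ht.2
    have hfd : ∀ l, DifferentiableAt ℝ (GeodesicHJ.transitionFamily c b χ lam l) (Ψ α) := fun l =>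
      (GeodesicHJ.contDiffAt_transitionFamily hlam.isOpen hχ hf l hj (c.map_source hφ)
        _).differentiableAt (by simp)
    refine GeodesicHJ.eq_zero_of_fderiv_transitionFamily hlam.isOpen hχ hT hTV hf hk hr hlam hΨT ?_
    -- At fixed x the coframe matrix does not depend on α, so differentiating ∂S/∂x^i = f_l ω^l_i
    -- only affects the f_l.
    have hpart : ∀ i, fderiv ℝ (fun α' => GeodesicHJ.partialDeriv
        (fun x' => GeodesicHJ.liftedIntegral e c x₀ S W x' α') i x) α δ =
        ∑ l, fderiv ℝ (GeodesicHJ.transitionFamily c b χ lam l) (Ψ α) (fderiv ℝ Ψ α δ) *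
          GeodesicHJ.coframeMatrix e b x₀ x l i := by
      intro i
      have h1 : HasFDerivAt (fun α' => ∑ l, GeodesicHJ.transitionFamily c b χ lam l (Ψ α') *
          GeodesicHJ.coframeMatrix e b x₀ x l i)
          (∑ l, GeodesicHJ.coframeMatrix e b x₀ x l i •
            (fderiv ℝ (GeodesicHJ.transitionFamily c b χ lam l) (Ψ α)).comp (fderiv ℝ Ψ α)) α :=
        HasFDerivAt.fun_sum fun l _ =>
          ((hfd l).hasFDerivAt.comp α hΨd.hasFDerivAt).mul_const _
      have h2 : (fun α' => GeodesicHJ.partialDeriv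
          (fun x' => GeodesicHJ.liftedIntegral e c x₀ S W x' α') i x) =ᶠ[nhds α]
          fun α' => ∑ l, GeodesicHJ.transitionFamily c b χ lam l (Ψ α') *
            GeodesicHJ.coframeMatrix e b x₀ x l i := by
        have hnear : ∀ᶠ α' in nhds α, (x, α') ∈ GeodesicHJ.liftedDomain e c x₀ D Ω :=
          (Continuous.prodMk_right x).continuousAt.eventually_mem
            ((GeodesicHJ.isOpen_liftedDomain hst he x₀ b hc hD hW hΩ).mem_nhds ht)
        filter_upwards [hnear] with α' hα'
        rw [GeodesicHJ.partialDeriv,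
          GeodesicHJ.fderiv_liftedIntegral hst he x₀ b hc hD hW hN hΩ hS hα',
          GeodesicHJ.coframeForm_apply]
        simp [hΨ]
      rw [h2.fderiv_eq, h1.fderiv]
      simp [sum_apply, mul_comm]
    have hvec : Matrix.vecMul (fun l => fderiv ℝ (GeodesicHJ.transitionFamily c b χ lam l) (Ψ α)
        (fderiv ℝ Ψ α δ)) (GeodesicHJ.coframeMatrix e b x₀ x) = 0 := by
      ext i
      exact (hpart i).symm.trans (hδ i)
    -- Multiplication by the frame matrix cancels the coframe and isolates the derivatives of the
    -- f_l.
    have h3 := congrArg (fun w => Matrix.vecMul w (GeodesicHJ.frameMatrix e b x₀ x)) hvec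
    simp only [Matrix.vecMul_vecMul, Matrix.zero_vecMul,
      GeodesicHJ.coframeMatrix_mul_frameMatrix hst he x₀ b hx, Matrix.vecMul_one] at h3
    exact fun l => congrFun h3 l
  have hrank : Module.finrank ℝ (GeodesicHJ.Coord r × GeodesicHJ.Coord k × GeodesicHJ.Coord r) = n := by
    simp only [Module.finrank_prod, finrank_euclideanSpace_fin]
    omega
  -- Any basis of the parameter space serves; its index set is `Fin n` because r + k + r = n.
  refine ⟨GeodesicHJ.isOpen_liftedDomain hst he x₀ b hc hD hW hΩ,
    GeodesicHJ.contDiffOn_liftedIntegral hst he x₀ b hc hD hW hΩ hS hN', ?_, ?_,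
    Module.finBasisOfFinrankEq ℝ _ hrank, ?_⟩
  · intro x α ht
    exact (hSc α.2.1 (hD ht.1).2.2.1).mass_nonneg _ _ ht.2
  · intro x α ht
    obtain ⟨hx, -, hj, -⟩ := hD ht.1
    rw [← (hSc α.2.1 hj).equation _ _ ht.2]
    refine GeodesicHJ.geodesicSymbol_eq_sum hst he x₀ b hG hx _ fun l => ?_
    have h1 := GeodesicHJ.fderiv_apply_eq_sum_partialDeriv
      (fun x' => GeodesicHJ.liftedIntegral e c x₀ S W x' α) x (GeodesicHJ.frameVector e b x₀ l x)
    rw [GeodesicHJ.fderiv_liftedIntegral hst he x₀ b hc hD hW hN hΩ hS ht,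
      GeodesicHJ.coframeForm_frameVector hst he x₀ b hx] at h1
    exact h1.symm
  · intro x α ht hdet
    -- A kernel vector of the mixed Hessian is a parameter direction along which ∂S/∂x is
    -- stationary, and `hnondeg` excludes it.
    obtain ⟨d, hd0, hd⟩ := Matrix.exists_mulVec_eq_zero_iff.mpr hdet
    have h1 := hnondeg x α ht (∑ l, d l • Module.finBasisOfFinrankEq ℝ _ hrank l) fun i => by
      have h2 := congrFun hd i
      simp only [Matrix.mulVec, dotProduct, Matrix.of_apply, Pi.zero_apply] at h2
      rw [map_sum]
      simp only [map_smul, smul_eq_mul]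
      rw [← h2]
      exact Finset.sum_congr rfl fun l _ => mul_comm _ _
    exact hd0 (funext fun l => Fintype.linearIndependent_iff.mp
      (Module.finBasisOfFinrankEq ℝ _ hrank).linearIndependent d h1 l)
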